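/- **Setting.** Let $A\in\mathbb R^{m\times n}$, $b\in\mathbb R^m$, $P\in\mathbb R^{3\times n}$, $\mathcal Q=\{Px: Ax=b,\ x\ge 0\}\subset\mathbb R^3$ and $\mathcal Q^+=\{y: y\ge y'\text{ for some }y'\in\mathcal Q\}$. Assume that $\mathcal Q$ lies in the non-negative orthant, that $0\notin\mathcal Q$, and let $q$ be an interior point of $\mathcal Q^+$. Extend the objective space by ideal points, using homogeneous coordinates: $(y,1)$ is the ordinary point $y$, and $(m,0)$ with $m\ge 0$, $m\neq 0$ is the ideal end of the ray in direction $m$ (the same point for all positive multiples of $m$); a point $(z,j)$ is on the non-negative side of the hyperplane $(w,d)$ if $zw+jd\ge 0$. Benson's algorithm maintains a polytope $S$, given by its bounding hyperplanes, and a set of marked vertices. It starts with the ideal simplex $S_0$, which has as vertices the origin and the ideal points $(e_1,0),(e_2,0),(e_3,0)$, and as facets the coordinate hyperplanes and the ideal plane; the three ideal vertices are marked. In each iteration (step) it selects an unmarked vertex $y$ of the current polytope and computes the optimum $\hat\lambda$ of $\max\{\lambda: q-\lambda(q-y)\ge Px,\ Ax=b,\ x\ge 0\}$. If $\hat\lambda=1$,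 then $y$ is marked. If $0<\hat\lambda<1$, then a solution $(\hat u,\hat v)$ of the dual program $\min\{bu+qv: A^Tu+P^Tv\ge0,\ (q-y)v=1,\ v\ge0\}$ with the same value $\hat\lambda$ is taken, and the next polytope is the part of the current one on the non-negative side of the hyperplane $(\hat v,-\hat y\hat v)$, where $\hat y=q-\hat\lambda(q-y)$. The algorithm terminates when all vertices are marked. **Theorem.** 1. If a run of the algorithm terminates after at most $M$ iterations, then each of the polytopes $S_0,S_1,\dots$ that occur during the run has at most $2M$ vertices (ordinary and ideal ones together). 2. Every three-dimensional convex polytope has finitely many facets, and if it has $v$ vertices and $f$ facets, then $v\le 2f-4$. 3. The number of vertices can increase linearly when facets are left out: let $n\ge 3$, and let $X\subset\mathbb R^3$ consist of two pyramids over the same regular $2n$-gon, glued along this common base, with apexes on opposite sides of the base plane on the line through the centre of the $2n$-gon perpendicular to that plane, at arbitrary positive heights. Then $X$ is a convex polytope with $2n+2$ vertices and $4n$ facets. The region bounded by the facets of $X$ that remain when every other facet of the top pyramid is left out is a convex polytope with $3n+2$ vertices. -/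

import Mathlib

open scoped Matrix

/-! ### Convex polytopes in `ℝ^d`, their facets -/

/-- A full-dimensional convex polytope in `ℝ^d`: a bounded intersection of finitely many closed
half-spaces, with nonempty interior. Its vertices are its extreme points
(`Set.extremePoints ℝ X`). -/
def IsFullPolytope {d : ℕ} (X : Set (Fin d → ℝ)) : Prop :=
  (∃ H : Set ((Fin d → ℝ) × ℝ), H.Finite ∧ X = {x | ∀ h ∈ H, h.1 ⬝ᵥ x ≤ h.2}) ∧
    Bornology.IsBounded X ∧ (interior X).Nonempty

/-- The facets of a convex set `X`: its nonempty exposed faces of codimension one in `X`. -/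
def facets {d : ℕ} (X : Set (Fin d → ℝ)) : Set (Set (Fin d → ℝ)) :=
  {F | F.Nonempty ∧ IsExposed ℝ X F ∧
    Module.finrank ℝ (vectorSpan ℝ F) + 1 = Module.finrank ℝ (vectorSpan ℝ X)}

/-- The region bounded by the members of `𝓕`, a family of facets of `X`: the intersection of all
half-spaces that contain `X` and whose bounding hyperplane contains a member of `𝓕`.
(The pair `w = 0`, `c = 0` imposes no condition.) -/
def boundedBy {d : ℕ} (X : Set (Fin d → ℝ)) (𝓕 : Set (Set (Fin d → ℝ))) : Set (Fin d → ℝ) :=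
  {y | ∀ F ∈ 𝓕, ∀ (w : Fin d → ℝ) (c : ℝ),
    (∀ x ∈ X, w ⬝ᵥ x ≤ c) → (∀ x ∈ F, w ⬝ᵥ x = c) → w ⬝ᵥ y ≤ c}

/-! ### The double pyramid over a regular `2n`-gon -/

/-- The `k`-th vertex of the regular `2n`-gon of circumradius `R` in the plane `z = 0`, centred at
the origin. -/
noncomputable def gonVertex (n : ℕ) (R : ℝ) (k : ℕ) : Fin 3 → ℝ :=
  ![R * Real.cos (Real.pi * k / n), R * Real.sin (Real.pi * k / n), 0]

/-- Two pyramids over the regular `2n`-gon, one of height `a` above the plane of the polygon and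
one of height `b` below it, joined together at their common base. -/
noncomputable def bipyramid (n : ℕ) (R a b : ℝ) : Set (Fin 3 → ℝ) :=
  convexHull ℝ (Set.range (gonVertex n R) ∪ {![0, 0, a], ![0, 0, -b]})

/-- The facet of the top pyramid over the `k`-th side of the polygon. -/
noncomputable def topFacet (n : ℕ) (R a : ℝ) (k : ℕ) : Set (Fin 3 → ℝ) :=
  convexHull ℝ {![0, 0, a], gonVertex n R k, gonVertex n R (k + 1)}

/-- The region bounded by the facets of the double pyramid that remain after every other facet of
the top pyramid has been left out. -/
noncomputable def reducedBipyramid (n : ℕ) (R a b : ℝ) : Set (Fin 3 → ℝ) :=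
  boundedBy (bipyramid n R a b)
    (facets (bipyramid n R a b) \ {F | ∃ j : ℕ, j < n ∧ F = topFacet n R a (2 * j)})

/-! ### Benson's outer approximation algorithm -/

namespace Benson

/-- The data of a linear multiobjective optimization problem with `n` variables, `m` constraints
and `p` objectives: minimize `P x` subject to `A x = b`, `x ≥ 0`. -/
structure Problem (p m n : ℕ) where
  A : Matrix (Fin m) (Fin n) ℝ
  b : Fin m → ℝ
  P : Matrix (Fin p) (Fin n) ℝ

variable {p m n : ℕ}

/-- The polytope `{x : A x = b, x ≥ 0}` in the problem space. -/
def Problem.feasible (D : Problem p m n) : Set (Fin n → ℝ) :=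
  {x | D.A *ᵥ x = D.b ∧ 0 ≤ x}

/-- `𝒬 = {P x : A x = b, x ≥ 0}` in the objective space. -/
def Problem.Q (D : Problem p m n) : Set (Fin p → ℝ) :=
  {y | ∃ x ∈ D.feasible, y = D.P *ᵥ x}

/-- `𝒬⁺ = {y : y ≥ y' for some y' ∈ 𝒬}`. -/
def Problem.Qplus (D : Problem p m n) : Set (Fin p → ℝ) :=
  {y | ∃ y' ∈ D.Q, y' ≤ y}

/-- The values `λ` for which the scalar linear program
`max {λ : q - λ d ≥ P x, A x = b, x ≥ 0}` has a feasible solution `(λ, x)`. -/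
def Problem.primalValues (D : Problem p m n) (q d : Fin p → ℝ) : Set ℝ :=
  {lam | ∃ x ∈ D.feasible, D.P *ᵥ x ≤ q - lam • d}

/-- Feasible solutions of the dual program
`min {b u + q v : Aᵀ u + Pᵀ v ≥ 0, d v = 1, v ≥ 0}`. -/
def Problem.DualFeasible (D : Problem p m n) (d : Fin p → ℝ) (u : Fin m → ℝ) (v : Fin p → ℝ) :
    Prop :=
  0 ≤ D.Aᵀ *ᵥ u + D.Pᵀ *ᵥ v ∧ d ⬝ᵥ v = 1 ∧ 0 ≤ v

/-- Homogeneous coordinates in the objective space extended by ideal elements. As a point, `(y, 1)`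
is the ordinary point `y` and `(m, 0)` is the ideal endpoint of the ray in direction `m`, which is
the same for all positive multiples of `m`. As a hyperplane, `(w, d)` consists of the points
`(z, j)` with `z w + j d = 0`. -/
abbrev Homog (p : ℕ) := (Fin p → ℝ) × ℝ

/-- The expression `z w + j d`, for the hyperplane `(w, d)` and the point `(z, j)`. -/
def side (h z : Homog p) : ℝ := z.1 ⬝ᵥ h.1 + z.2 * h.2

/-- The set of all homogeneous coordinate vectors on the non-negative side of each of the
hyperplanes: the polytope that they bound. -/
def region (H : Set (Homog p)) : Set (Homog p) := {z | ∀ h ∈ H, 0 ≤ side h z}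

/-- The chosen homogeneous coordinates of a point: `(y, 1)` for an ordinary point, and `(m, 0)` with
`∑ i, m i = 1` for an ideal point. Each nonzero vector with non-negative coordinates has exactly
one positive multiple of this form. -/
def Normalized (z : Homog p) : Prop := z.2 = 1 ∨ (z.2 = 0 ∧ ∑ i, z.1 i = 1)

/-- The vertices, ordinary and ideal, of the polytope bounded by `H`: the points whose homogeneous
coordinates span an extreme ray of the cone `region H`. -/
def vertices (H : Set (Homog p)) : Set (Homog p) :=
  {z | Normalized z ∧ z ∈ region H ∧
    ∀ z₁ ∈ region H, ∀ z₂ ∈ region H, z₁ + z₂ = z → ∃ t : ℝ, z₁ = t • z}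

/-- The current polytope, given by its bounding hyperplanes, and the set of points that are marked
as boundary points of `𝒬⁺`. -/
structure State (p : ℕ) where
  planes : Set (Homog p)
  marked : Set (Homog p)

/-- The initial state: the ideal simplex `S₀` bounded by the coordinate hyperplanes and the ideal
plane, with the ideal points at the ends of the coordinate axes marked as boundary points. -/
def initial (p : ℕ) : State p where
  planes := insert (0, 1) (Set.range fun i : Fin p => (Pi.single i 1, 0))
  marked := Set.range fun i : Fin p => (Pi.single i 1, 0)

/-- One iteration of the algorithm with internal point `q`. A vertex `y` not marked as a boundary
point is selected, and the scalar linear program for `q` and the direction `q - y` is solved.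
* If the optimum is `1`, then `y` is marked as a boundary point.
* If the optimum `lam` is smaller, then a dual solution `(u, v)` with the same value is taken, and
  the hyperplane `(v, -ŷ v)` through `ŷ = q - lam (q - y)` is added to the bounding hyperplanes. -/
inductive Step (D : Problem p m n) (q : Fin p → ℝ) : State p → State p → Prop
  | mark (s : State p) (y : Fin p → ℝ)
      (vertex : (y, 1) ∈ vertices s.planes) (unmarked : (y, 1) ∉ s.marked)
      (optimum : IsGreatest (D.primalValues q (q - y)) 1) :
      Step D q s ⟨s.planes, insert (y, 1) s.marked⟩
  | cut (s : State p) (y : Fin p → ℝ) (lam : ℝ) (u : Fin m → ℝ) (v : Fin p → ℝ)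
      (vertex : (y, 1) ∈ vertices s.planes) (unmarked : (y, 1) ∉ s.marked)
      (optimum : IsGreatest (D.primalValues q (q - y)) lam) (pos : 0 < lam) (lt_one : lam < 1)
      (dual : D.DualFeasible (q - y) u v) (value : D.b ⬝ᵥ u + q ⬝ᵥ v = lam) :
      Step D q s ⟨insert (v, -((q - lam • (q - y)) ⬝ᵥ v)) s.planes, s.marked⟩

/-- The algorithm terminates when every vertex is marked. -/
def Terminated (s : State p) : Prop := vertices s.planes ⊆ s.marked

/-- `σ 0, …, σ N` is a complete run of the algorithm, consisting of `N` iterations. -/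
def IsRun (D : Problem p m n) (q : Fin p → ℝ) (N : ℕ) (σ : ℕ → State p) : Prop :=
  σ 0 = initial p ∧ (∀ i < N, Step D q (σ i) (σ (i + 1))) ∧ Terminated (σ N)

end Benson

/-! The bound v ≤ 2f - 4 is obtained by sweeping, without Euler's formula. Choose a linear
functional `w` that separates the vertices. Every facet has one lowest and one highest vertex, which
gives 2f pairs of a facet and an end. Every vertex is an end of some facet through it
(`Irredundant.exists_face_extremal`); the lowest and the highest vertex of the whole polytope are
ends of all facets through them, hence of at least three each. So 2f ≥ (v - 2) + 3 + 3. To have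
inequalities correspond exactly to facets, the system is first reduced to an irredundant one
(`exists_irredundant_subsystem`, `Irredundant.facets_eq`).

For the algorithm, the homogeneous cone lies in the non-negative orthant, so cutting it with the
hyperplane "coordinate sum 1" gives a bounded polytope whose vertices account for ordinary and ideal
vertices alike; the ideal plane becomes one bounding plane among others. Let a run have N
iterations, C of them cuts. Then C ≥ 1, since the origin is not in 𝒬⁺ and must be cut off, and C <
N, since the last polytope has an ordinary vertex, which must have been marked. A polytope that
occurs before the last cut has at most 4 + (C - 1) planes, hence at most 2(C + 3) - 4 ≤ 2N vertices.
After the last cut the polytope is the final one, all its vertices are marked, and there are at most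
3 + (N - C) ≤ N + 2 ≤ 2N marked points.

For the double pyramid, angles are counted in units of π/(2n): polygon vertices sit at even
multiples, side midpoints at odd ones. Both the full and the reduced pyramid are instances of
`cutPyramid`. Leaving out the top facet over side k creates one new vertex `outer`, where the k-th
bottom plane meets the two neighbouring top planes. A decomposition into half-sectors shows that the
inequalities define the convex hull of the listed points, and the tight inequalities at each point
show that it is extreme. -/

/-! ### Systems of linear inequalities -/

namespace Halfspaces

variable {ι : Type*} {d : ℕ}

/-- The solution set of the system of inequalities `a i ⬝ᵥ x ≤ c i`. -/
def polyhedron (a : ι → Fin d → ℝ) (c : ι → ℝ) : Set (Fin d → ℝ) := {x | ∀ i, a i ⬝ᵥ x ≤ c i}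

/-- The face of the polyhedron on which the `i`-th inequality is tight. -/
def face (a : ι → Fin d → ℝ) (c : ι → ℝ) (i : ι) : Set (Fin d → ℝ) :=
  {x | x ∈ polyhedron a c ∧ a i ⬝ᵥ x = c i}

/-- A system of inequalities with a strict solution, and for each inequality a point at which
it is the only tight one. -/
structure Irredundant (a : ι → Fin d → ℝ) (c : ι → ℝ) : Prop where
  exists_strict : ∃ p, ∀ i, a i ⬝ᵥ p < c i
  exists_tight : ∀ i, ∃ y, a i ⬝ᵥ y = c i ∧ ∀ j, j ≠ i → a j ⬝ᵥ y < c j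

variable {a : ι → Fin d → ℝ} {c : ι → ℝ}

theorem isClosed_polyhedron : IsClosed (polyhedron a c) := by
  have : polyhedron a c = ⋂ i, {x | a i ⬝ᵥ x ≤ c i} := by ext; simp [polyhedron]
  rw [this]
  refine isClosed_iInter fun i => isClosed_le ?_ continuous_const
  unfold dotProduct
  fun_prop

theorem convex_polyhedron : Convex ℝ (polyhedron a c) := by
  intro x hx y hy s t hs ht hst i
  have h1 := mul_le_mul_of_nonneg_left (hx i) hs
  have h2 := mul_le_mul_of_nonneg_left (hy i) ht
  have h3 : c i = s * c i + t * c i := by rw [← add_mul, hst, one_mul]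
  simp only [dotProduct_add, dotProduct_smul, smul_eq_mul]
  linarith

theorem isClosed_face (i : ι) : IsClosed (face a c i) := by
  refine isClosed_polyhedron.inter (isClosed_eq (f := fun x => a i ⬝ᵥ x) ?_ continuous_const)
  unfold dotProduct
  fun_prop

/-- Slack inequalities survive a small move by continuity, so only the tight ones restrict the
direction. -/
theorem eventually_mem_of_tight [Finite ι] {x e : Fin d → ℝ} (hx : x ∈ polyhedron a c)
    (he : ∀ i, a i ⬝ᵥ x = c i → a i ⬝ᵥ e ≤ 0) :
    ∀ᶠ t : ℝ in nhdsWithin 0 (Set.Ioi 0), x + t • e ∈ polyhedron a c := by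
  refine Filter.eventually_all.2 fun i => ?_
  rcases (hx i).lt_or_eq with h | h
  · have : Filter.Tendsto (fun t : ℝ => a i ⬝ᵥ (x + t • e)) (nhds 0) (nhds (a i ⬝ᵥ x)) := by
      have hc : Continuous (fun t : ℝ => a i ⬝ᵥ (x + t • e)) := by
        unfold dotProduct
        fun_prop
      simpa using hc.tendsto 0
    exact ((this.eventually (gt_mem_nhds h)).filter_mono nhdsWithin_le_nhds).mono fun t ht => ht.le
  · filter_upwards [self_mem_nhdsWithin] with t ht
    have := mul_nonpos_of_nonneg_of_nonpos (le_of_lt ht) (he i h)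
    simp only [dotProduct_add, dotProduct_smul, smul_eq_mul]
    linarith

theorem exists_mem_of_tight [Finite ι] {x e : Fin d → ℝ} (hx : x ∈ polyhedron a c)
    (he : ∀ i, a i ⬝ᵥ x = c i → a i ⬝ᵥ e = 0) :
    ∃ t : ℝ, 0 < t ∧ x + t • e ∈ polyhedron a c ∧ x - t • e ∈ polyhedron a c := by
  have h1 := eventually_mem_of_tight hx fun i hi => (he i hi).le
  have h2 := eventually_mem_of_tight (e := -e) hx fun i hi => by simp [he i hi]
  obtain ⟨t, ⟨ht1, ht2⟩, ht0⟩ := ((h1.and h2).and self_mem_nhdsWithin).exists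
  exact ⟨t, ht0, ht1, by simpa [sub_eq_add_neg] using ht2⟩

/-- A nonzero direction along all tight hyperplanes would make `x` the midpoint of a segment in the
polyhedron. -/
theorem eq_zero_of_mem_extremePoints [Finite ι] {x e : Fin d → ℝ}
    (hx : x ∈ (polyhedron a c).extremePoints ℝ) (he : ∀ i, a i ⬝ᵥ x = c i → a i ⬝ᵥ e = 0) :
    e = 0 := by
  obtain ⟨t, ht, h1, h2⟩ := exists_mem_of_tight hx.1 he
  have : x + t • e = x := hx.2 h1 h2 ⟨1 / 2, 1 / 2, by norm_num, by norm_num, by norm_num, by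
    ext i; simp; ring⟩
  rw [add_eq_left] at this
  exact (smul_eq_zero.1 this).resolve_left ht.ne'

/-- A point is extreme if it is the only solution of the equations given by tight inequalities. -/
theorem mem_extremePoints_of_forall_tight {x : Fin d → ℝ} (hx : x ∈ polyhedron a c) (J : Set ι)
    (hJ : ∀ i ∈ J, a i ⬝ᵥ x = c i) (huniq : ∀ y, (∀ i ∈ J, a i ⬝ᵥ y = c i) → y = x) :
    x ∈ (polyhedron a c).extremePoints ℝ := by
  refine ⟨hx, fun y hy z hz hyz => huniq y fun i hi => ?_⟩
  obtain ⟨s, t, hs, ht, hst, rfl⟩ := hyz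
  have h := hJ i hi
  simp only [dotProduct_add, dotProduct_smul, smul_eq_mul] at h
  refine le_antisymm (hy i) ?_
  have h2 := mul_le_mul_of_nonneg_left (hz i) ht.le
  have h3 : c i = s * c i + t * c i := by rw [← add_mul, hst, one_mul]
  have h4 : s * c i ≤ s * (a i ⬝ᵥ y) := by linarith
  exact le_of_mul_le_mul_left h4 hs

/-- An extreme point is determined by its set of tight inequalities, and there are finitely many
such sets. -/
theorem finite_extremePoints [Finite ι] : ((polyhedron a c).extremePoints ℝ).Finite := by
  refine Set.Finite.of_injOn (f := fun x => {i | a i ⬝ᵥ x = c i}) (t := Set.univ)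
    (fun _ _ => Set.mem_univ _) ?_ Set.finite_univ
  intro x hx y hy hxy
  have hxy' : ∀ i, a i ⬝ᵥ x = c i ↔ a i ⬝ᵥ y = c i := fun i => Set.ext_iff.1 hxy i
  have := eq_zero_of_mem_extremePoints (e := y - x) hx fun i hi => by
    rw [dotProduct_sub, hi, (hxy' i).1 hi, sub_self]
  exact (sub_eq_zero.1 this).symm

/-- At an extreme point of a polyhedron in `ℝ^d`, at least `d` inequalities are tight. -/
theorem le_card_tight [Finite ι] {x : Fin d → ℝ} (hx : x ∈ (polyhedron a c).extremePoints ℝ)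
    (J : Finset ι) (hJ : ∀ i, a i ⬝ᵥ x = c i → i ∈ J) : d ≤ J.card := by
  by_contra! hlt
  let f : (Fin d → ℝ) →ₗ[ℝ] (J → ℝ) := LinearMap.pi fun i => dotProductBilin ℝ ℝ (a i)
  have hf : LinearMap.ker f ≠ ⊥ := LinearMap.ker_ne_bot_of_finrank_lt (by simpa using hlt)
  obtain ⟨e, he, he0⟩ := Submodule.exists_mem_ne_zero_of_ne_bot hf
  refine he0 (eq_zero_of_mem_extremePoints hx fun i hi => ?_)
  exact congrFun (LinearMap.mem_ker.1 he) ⟨i, hJ i hi⟩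

theorem isExtreme_face (i : ι) : IsExtreme ℝ (polyhedron a c) (face a c i) := by
  refine ⟨fun x hx => hx.1, fun x hx y hy z hz hxyz => ⟨hx, ?_⟩⟩
  obtain ⟨s, t, hs, ht, hst, rfl⟩ := hxyz
  have h := hz.2
  simp only [dotProduct_add, dotProduct_smul, smul_eq_mul] at h
  refine le_antisymm (hx i) ?_
  have h2 := mul_le_mul_of_nonneg_left (hy i) ht.le
  have h3 : c i = s * c i + t * c i := by rw [← add_mul, hst, one_mul]
  have h4 : s * c i ≤ s * (a i ⬝ᵥ x) := by linarith
  exact le_of_mul_le_mul_left h4 hs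

/-- A linear functional attains its maximum over a compact extreme subset of `X` at an extreme
point of `X`. -/
theorem exists_extremePoint_forall_le {X K : Set (Fin d → ℝ)} (hK : IsCompact K)
    (hne : K.Nonempty) (hKX : IsExtreme ℝ X K) (w : Fin d → ℝ) :
    ∃ v ∈ X.extremePoints ℝ, v ∈ K ∧ ∀ x ∈ K, w ⬝ᵥ x ≤ w ⬝ᵥ v := by
  let l : StrongDual ℝ (Fin d → ℝ) := LinearMap.toContinuousLinearMap (dotProductBilin ℝ ℝ w)
  have hl : ∀ x, l x = w ⬝ᵥ x := fun x => rfl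
  have hexp : IsExposed ℝ K (l.toExposed K) := ContinuousLinearMap.toExposed.isExposed
  obtain ⟨x, hx, hmax⟩ := hK.exists_isMaxOn hne l.continuous.continuousOn
  have hcomp : IsCompact (l.toExposed K) := hexp.isCompact hK
  obtain ⟨v, hv⟩ := hcomp.extremePoints_nonempty ⟨x, hx, fun y hy => hmax hy⟩
  exact ⟨v, (hKX.trans hexp.isExtreme).extremePoints_subset_extremePoints hv, hv.1.1,
    fun y hy => hv.1.2 y hy⟩

/-- Supplies the generic sweep direction: `w` has to avoid the hyperplanes orthogonal to the
finitely many differences of distinct points of `V`. -/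
theorem exists_injOn_dotProduct {V : Set (Fin d → ℝ)} (hV : V.Finite) :
    ∃ w : Fin d → ℝ, Set.InjOn (fun x => w ⬝ᵥ x) V := by
  have : Finite V := hV
  obtain ⟨w, hw⟩ := Module.Dual.exists_forall_ne_zero_of_forall_exists
    (ι := {p : V × V // p.1 ≠ p.2}) (K := ℝ) (M := Fin d → ℝ)
    (fun p => dotProductBilin ℝ ℝ ((p.1.1 : Fin d → ℝ) - p.1.2)) (by
      rintro ⟨⟨⟨x, hx⟩, ⟨y, hy⟩⟩, hne⟩
      refine ⟨x - y, fun h => hne ?_⟩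
      have : x - y = 0 := dotProduct_self_eq_zero.1 h
      exact Subtype.ext (sub_eq_zero.1 this))
  refine ⟨w, fun x hx y hy hxy => ?_⟩
  by_contra hne
  refine hw ⟨⟨⟨x, hx⟩, ⟨y, hy⟩⟩, fun h => hne (congrArg Subtype.val h)⟩ ?_
  change (x - y) ⬝ᵥ w = 0
  rw [dotProduct_comm, dotProduct_sub]
  exact sub_eq_zero.2 hxy

end Halfspaces

namespace Halfspaces

variable {ι : Type*} {d : ℕ}
variable {a : ι → Fin d → ℝ} {c : ι → ℝ}

/-! ### Vertices of three-dimensional polytopes -/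

/-- If a face `F i` through `v` contains points on both sides of the plane `w ⬝ᵥ x = w ⬝ᵥ v`, then
this plane contains a direction at `v` that points into the relative interior of the face. -/
theorem Irredundant.exists_direction (h : Irredundant a c) {v w : Fin d → ℝ} {i : ι}
    (hi : a i ⬝ᵥ v = c i) (hlt : ∃ x ∈ face a c i, w ⬝ᵥ x < w ⬝ᵥ v)
    (hgt : ∃ x ∈ face a c i, w ⬝ᵥ v < w ⬝ᵥ x) :
    ∃ e, w ⬝ᵥ e = 0 ∧ a i ⬝ᵥ e = 0 ∧ ∀ j, a j ⬝ᵥ v = c j → j ≠ i → a j ⬝ᵥ e < 0 := by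
  obtain ⟨y, hy, hy'⟩ := h.exists_tight i
  -- The point `y` lies in the relative interior of the face. A positive share of `y - v` makes the
  -- other inequalities tight at `v` strictly negative, and `x`, taken on the other side of the
  -- plane from `y`, balances the value of `w`.
  have key : ∀ x ∈ face a c i, ∀ r s : ℝ, 0 < r → 0 ≤ s →
      r * (w ⬝ᵥ y - w ⬝ᵥ v) + s * (w ⬝ᵥ x - w ⬝ᵥ v) = 0 →
      ∃ e, w ⬝ᵥ e = 0 ∧ a i ⬝ᵥ e = 0 ∧ ∀ j, a j ⬝ᵥ v = c j → j ≠ i → a j ⬝ᵥ e < 0 := by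
    intro x hx r s hr hs heq
    refine ⟨r • (y - v) + s • (x - v), ?_, ?_, fun j hj hji => ?_⟩ <;>
      simp only [dotProduct_add, dotProduct_smul, dotProduct_sub, smul_eq_mul]
    · exact heq
    · rw [hy, hi, hx.2]; ring
    · have h1 := mul_neg_of_pos_of_neg hr (sub_neg.2 (hy' j hji))
      have h2 := mul_nonpos_of_nonneg_of_nonpos hs (sub_nonpos.2 (hx.1 j))
      rw [hj]; linarith
  obtain ⟨x, hx, hxlt⟩ := hlt
  obtain ⟨x', hx', hxgt⟩ := hgt
  rcases le_total (w ⬝ᵥ v) (w ⬝ᵥ y) with hle | hle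
  · exact key x hx (w ⬝ᵥ v - w ⬝ᵥ x) (w ⬝ᵥ y - w ⬝ᵥ v) (sub_pos.2 hxlt) (sub_nonneg.2 hle) (by ring)
  · exact key x' hx' (w ⬝ᵥ x' - w ⬝ᵥ v) (w ⬝ᵥ v - w ⬝ᵥ y) (sub_pos.2 hxgt) (sub_nonneg.2 hle)
      (by ring)

/-- Three vectors in the plane orthogonal to `w` are linearly dependent. Pairing a dependence `t`
with `n j` leaves two terms with negative factors, so the other two coefficients have opposite signs
or both vanish. Three numbers cannot have pairwise opposite signs. -/
theorem not_three_directions {w : Fin 3 → ℝ} (hw : w ≠ 0) (n e : Fin 3 → Fin 3 → ℝ)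
    (hwe : ∀ i, w ⬝ᵥ e i = 0) (hdiag : ∀ i, n i ⬝ᵥ e i = 0)
    (hneg : ∀ i j, j ≠ i → n j ⬝ᵥ e i < 0) : False := by
  have hdet : (Matrix.of e).det = 0 := Matrix.exists_mulVec_eq_zero_iff.1
    ⟨w, hw, funext fun i => (dotProduct_comm _ _).trans (hwe i)⟩
  obtain ⟨t, ht, hte⟩ := Matrix.exists_vecMul_eq_zero_iff.2 hdet
  have hs : ∀ j, t 0 * (n j ⬝ᵥ e 0) + t 1 * (n j ⬝ᵥ e 1) + t 2 * (n j ⬝ᵥ e 2) = 0 := by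
    intro j
    have := Matrix.dotProduct_mulVec t (Matrix.of e) (n j)
    rw [hte, zero_dotProduct] at this
    have h2 : Matrix.of e *ᵥ n j = fun i => n j ⬝ᵥ e i := funext fun i => dotProduct_comm _ _
    rw [h2] at this
    simpa [dotProduct, Fin.sum_univ_three] using this
  have aux : ∀ x y p q : ℝ, p < 0 → q < 0 → x * p + y * q = 0 → x * y ≤ 0 ∧ (x = 0 → y = 0) := by
    intro x y p q hp hq h
    constructor
    · by_contra! hxy
      rcases pos_and_pos_or_neg_and_neg_of_mul_pos hxy with ⟨hx, hy⟩ | ⟨hx, hy⟩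
      · nlinarith [mul_pos hx (neg_pos.2 hp), mul_pos hy (neg_pos.2 hq)]
      · nlinarith [mul_pos (neg_pos.2 hx) (neg_pos.2 hp), mul_pos (neg_pos.2 hy) (neg_pos.2 hq)]
    · rintro rfl
      simpa [hq.ne] using h
  have h0 := hs 0
  have h1 := hs 1
  have h2 := hs 2
  rw [hdiag] at h0 h1 h2
  obtain ⟨h12, h12'⟩ := aux (t 1) (t 2) _ _ (hneg 1 0 (by decide)) (hneg 2 0 (by decide))
    (by linarith)
  obtain ⟨h02, h02'⟩ := aux (t 0) (t 2) _ _ (hneg 0 1 (by decide)) (hneg 2 1 (by decide))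
    (by linarith)
  obtain ⟨h01, h01'⟩ := aux (t 0) (t 1) _ _ (hneg 0 2 (by decide)) (hneg 1 2 (by decide))
    (by linarith)
  obtain ⟨-, h20'⟩ := aux (t 2) (t 0) _ _ (hneg 2 1 (by decide)) (hneg 0 1 (by decide))
    (by linarith)
  have hzero : t 0 = 0 := by
    by_contra h
    have h1 : t 1 ≠ 0 := fun h1 => h (h20' (h12' h1))
    have h2 : t 2 ≠ 0 := fun h2 => h (h20' h2)
    -- The product of the three pairwise products is this square, yet each of those products is at
    -- most zero.
    have hprod : 0 < (t 0 * t 1 * t 2) ^ 2 := by positivity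
    nlinarith [mul_nonneg (mul_nonneg (neg_nonneg.2 h12) (neg_nonneg.2 h02)) (neg_nonneg.2 h01)]
  refine ht (funext fun i => ?_)
  fin_cases i
  · exact hzero
  · exact h01' hzero
  · exact h02' hzero

/-- Every vertex of a three-dimensional polytope minimizes or maximizes a given nonzero functional
on some facet through it. -/
theorem Irredundant.exists_face_extremal [Finite ι] {a : ι → Fin 3 → ℝ} (h : Irredundant a c)
    {v w : Fin 3 → ℝ} (hv : v ∈ (polyhedron a c).extremePoints ℝ) (hw : w ≠ 0) :
    ∃ i, v ∈ face a c i ∧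
      ((∀ x ∈ face a c i, w ⬝ᵥ v ≤ w ⬝ᵥ x) ∨ ∀ x ∈ face a c i, w ⬝ᵥ x ≤ w ⬝ᵥ v) := by
  classical
  by_contra! hcon
  have hdir : ∀ i, a i ⬝ᵥ v = c i →
      ∃ e, w ⬝ᵥ e = 0 ∧ a i ⬝ᵥ e = 0 ∧ ∀ j, a j ⬝ᵥ v = c j → j ≠ i → a j ⬝ᵥ e < 0 := fun i hi =>
    h.exists_direction hi (hcon i ⟨hv.1, hi⟩).1 (hcon i ⟨hv.1, hi⟩).2
  have := Fintype.ofFinite ι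
  have hcard := le_card_tight hv (Finset.univ.filter fun i => a i ⬝ᵥ v = c i) (by simp)
  obtain ⟨i, hi, j, hj, k, hk, hij, hik, hjk⟩ := Finset.two_lt_card.1 hcard
  simp only [Finset.mem_filter, Finset.mem_univ, true_and] at hi hj hk
  obtain ⟨ei, hi1, hi2, hi3⟩ := hdir i hi
  obtain ⟨ej, hj1, hj2, hj3⟩ := hdir j hj
  obtain ⟨ek, hk1, hk2, hk3⟩ := hdir k hk
  refine not_three_directions hw ![a i, a j, a k] ![ei, ej, ek] ?_ ?_ ?_
  · intro r; fin_cases r <;> assumption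
  · intro r; fin_cases r <;> assumption
  · intro r s hrs
    fin_cases r <;> fin_cases s <;> first | exact absurd rfl hrs | skip
    · exact hi3 j hj hij.symm
    · exact hi3 k hk hik.symm
    · exact hj3 i hi hij
    · exact hj3 k hk hjk.symm
    · exact hk3 i hi hik
    · exact hk3 j hj hjk

/-- A three-dimensional polytope with `f` facets has at most `2 f - 4` vertices. -/
theorem Irredundant.encard_extremePoints_add_four_le [Fintype ι] {a : ι → Fin 3 → ℝ}
    (h : Irredundant a c) (hb : Bornology.IsBounded (polyhedron a c)) :
    ((polyhedron a c).extremePoints ℝ).encard + 4 ≤ 2 * (Fintype.card ι : ℕ∞) := by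
  classical
  -- The two points `0` and `Pi.single 0 1` are added only to force `w ≠ 0`.
  obtain ⟨w, hw⟩ := exists_injOn_dotProduct
    ((finite_extremePoints (a := a) (c := c)).union (Set.toFinite {0, Pi.single 0 1}))
  have hw0 : w ≠ 0 := by
    rintro rfl
    have h01 := hw (x₁ := 0) (x₂ := Pi.single 0 1) (by simp) (by simp) (by simp)
    simpa using congrFun h01 0
  replace hw : Set.InjOn (fun x => w ⬝ᵥ x) ((polyhedron a c).extremePoints ℝ) :=
    hw.mono Set.subset_union_left
  obtain ⟨V, hV⟩ := (finite_extremePoints (a := a) (c := c)).exists_finset_coe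
  have hVm : ∀ {x}, x ∈ V ↔ x ∈ (polyhedron a c).extremePoints ℝ := fun {x} => by
    rw [← hV, Finset.mem_coe]
  have hcomp : IsCompact (polyhedron a c) := Metric.isCompact_of_isClosed_isBounded
    isClosed_polyhedron hb
  obtain ⟨p, hp⟩ := h.exists_strict
  have hpP : p ∈ polyhedron a c := fun i => (hp i).le
  have hfne : ∀ i, (face a c i).Nonempty := fun i => by
    obtain ⟨y, hy, hy'⟩ := h.exists_tight i
    refine ⟨y, fun j => ?_, hy⟩
    rcases eq_or_ne j i with rfl | hji
    · exact hy.le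
    · exact (hy' j hji).le
  have hfc : ∀ i, IsCompact (face a c i) := fun i =>
    hcomp.of_isClosed_subset (isClosed_face i) fun x hx => hx.1
  choose M hMV hMF hM using fun i =>
    exists_extremePoint_forall_le (hfc i) (hfne i) (isExtreme_face i) w
  choose m hmV hmF hm using fun i =>
    exists_extremePoint_forall_le (hfc i) (hfne i) (isExtreme_face i) (-w)
  obtain ⟨v₁, hv₁V, -, hv₁⟩ :=
    exists_extremePoint_forall_le hcomp ⟨p, hpP⟩ IsExtreme.rfl w
  obtain ⟨v₀, hv₀V, -, hv₀⟩ :=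
    exists_extremePoint_forall_le hcomp ⟨p, hpP⟩ IsExtreme.rfl (-w)
  simp only [neg_dotProduct, neg_le_neg_iff] at hm hv₀
  have hM_eq : ∀ {v i}, v ∈ V → v ∈ face a c i → (∀ x ∈ face a c i, w ⬝ᵥ x ≤ w ⬝ᵥ v) → M i = v :=
    fun {v i} hv hvi hmax => hw (hMV i) (hVm.1 hv) (le_antisymm (hmax _ (hMF i)) (hM i v hvi))
  have hm_eq : ∀ {v i}, v ∈ V → v ∈ face a c i → (∀ x ∈ face a c i, w ⬝ᵥ v ≤ w ⬝ᵥ x) → m i = v :=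
    fun {v i} hv hvi hmin => hw (hmV i) (hVm.1 hv) (le_antisymm (hm i v hvi) (hmin _ (hmF i)))
  -- Otherwise `w` would be constant on the polytope, but it changes when the strict solution `p` is
  -- moved along `w`.
  have hne : v₀ ≠ v₁ := by
    rintro rfl
    obtain ⟨t, ht, h1, h2⟩ := exists_mem_of_tight (e := w) hpP fun i hi => absurd hi (hp i).ne
    have h3 : w ⬝ᵥ (p + t • w) ≤ w ⬝ᵥ (p - t • w) := (hv₁ _ h1).trans (hv₀ _ h2)
    have h4 : 0 < w ⬝ᵥ w := lt_of_le_of_ne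
      (Finset.sum_nonneg fun i _ => mul_self_nonneg (w i))
      fun h => hw0 (dotProduct_self_eq_zero.1 h.symm)
    have h5 := mul_pos ht h4
    simp only [dotProduct_add, dotProduct_sub, dotProduct_smul, smul_eq_mul] at h3
    linarith
  -- `g v` counts the facets with lowest vertex `v` and those with highest vertex `v`; double
  -- counting gives the total `2 f`.
  let g : (Fin 3 → ℝ) → ℕ := fun v =>
    (Finset.univ.filter fun i => m i = v).card + (Finset.univ.filter fun i => M i = v).card
  have hsum : ∑ v ∈ V, g v = 2 * Fintype.card ι := by
    rw [Finset.sum_add_distrib,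
      ← Finset.card_eq_sum_card_fiberwise (f := m) (s := Finset.univ) (t := V)
        (fun i _ => hVm.2 (hmV i)),
      ← Finset.card_eq_sum_card_fiberwise (f := M) (s := Finset.univ) (t := V)
        (fun i _ => hVm.2 (hMV i)), Finset.card_univ]
    ring
  have hg₀ : 3 ≤ g v₀ := (le_card_tight hv₀V _ fun i hi => by
    have hvi : v₀ ∈ face a c i := ⟨hv₀V.1, hi⟩
    simpa using hm_eq (hVm.2 hv₀V) hvi fun x hx => hv₀ x hx.1).trans (Nat.le_add_right _ _)
  have hg₁ : 3 ≤ g v₁ := (le_card_tight hv₁V _ fun i hi => by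
    have hvi : v₁ ∈ face a c i := ⟨hv₁V.1, hi⟩
    simpa using hM_eq (hVm.2 hv₁V) hvi fun x hx => hv₁ x hx.1).trans (Nat.le_add_left _ _)
  have hg : ∀ v ∈ V, 1 ≤ g v := by
    intro v hv
    obtain ⟨i, hvi, hmin | hmax⟩ := h.exists_face_extremal (hVm.1 hv) hw0
    · have : 0 < (Finset.univ.filter fun i => m i = v).card :=
        Finset.card_pos.2 ⟨i, by simpa using hm_eq hv hvi hmin⟩
      simp only [g]; omega
    · have : 0 < (Finset.univ.filter fun i => M i = v).card :=
        Finset.card_pos.2 ⟨i, by simpa using hM_eq hv hvi hmax⟩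
      simp only [g]; omega
  -- Each vertex contributes at least 1 and the two global extremes contribute 2 more each, which is
  -- the summand 4 in the bound.
  have hle : ∑ v ∈ V, (1 + (if v = v₀ then 2 else 0) + (if v = v₁ then 2 else 0)) ≤ ∑ v ∈ V, g v := by
    refine Finset.sum_le_sum fun v hv => ?_
    by_cases h0 : v = v₀
    · subst h0
      simpa [hne] using hg₀
    · by_cases h1 : v = v₁
      · subst h1
        simpa [h0] using hg₁
      · simpa [h0, h1] using hg v hv
  rw [hsum, Finset.sum_add_distrib, Finset.sum_add_distrib, Finset.sum_ite_eq', Finset.sum_ite_eq',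
    if_pos (hVm.2 hv₀V), if_pos (hVm.2 hv₁V), Finset.sum_const, smul_eq_mul, mul_one] at hle
  rw [← hV, Set.encard_coe_eq_coe_finsetCard]
  exact_mod_cast hle

end Halfspaces

namespace Halfspaces

variable {ι : Type*} {d : ℕ}
variable {a : ι → Fin d → ℝ} {c : ι → ℝ}

/-! ### Facets -/

theorem interior_polyhedron_nonempty [Finite ι] {p : Fin d → ℝ} (hp : ∀ i, a i ⬝ᵥ p < c i) :
    (interior (polyhedron a c)).Nonempty := by
  have hopen : IsOpen (⋂ i, {x | a i ⬝ᵥ x < c i}) := isOpen_iInter_of_finite fun i =>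
    isOpen_lt (by unfold dotProduct; fun_prop) continuous_const
  exact ⟨p, interior_maximal (fun x hx i => (Set.mem_iInter.1 hx i).le) hopen (Set.mem_iInter.2 hp)⟩

theorem isFullPolytope_polyhedron [Finite ι] {p : Fin d → ℝ} (hp : ∀ i, a i ⬝ᵥ p < c i)
    (hb : Bornology.IsBounded (polyhedron a c)) : IsFullPolytope (polyhedron a c) := by
  refine ⟨⟨Set.range fun i => (a i, c i), Set.finite_range _, ?_⟩, hb,
    interior_polyhedron_nonempty hp⟩
  ext x
  simp [polyhedron]

theorem Irredundant.finrank_vectorSpan [Finite ι] (h : Irredundant a c) :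
    Module.finrank ℝ (vectorSpan ℝ (polyhedron a c)) = d := by
  obtain ⟨p, hp⟩ := h.exists_strict
  have := affineSpan_eq_top_of_nonempty_interior
    ((interior_polyhedron_nonempty hp).mono (interior_mono (subset_convexHull ℝ _)))
  rw [← direction_affineSpan, this, AffineSubspace.direction_top, finrank_top,
    Module.finrank_fin_fun]

/-- From a point where only the `i`-th inequality is tight, a small move in any direction of its
hyperplane stays in the face. -/
theorem Irredundant.vectorSpan_face [Finite ι] (h : Irredundant a c) (i : ι) :
    vectorSpan ℝ (face a c i) = LinearMap.ker (dotProductBilin ℝ ℝ (a i)) := by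
  apply le_antisymm
  · refine Submodule.span_le.2 ?_
    rintro _ ⟨x, hx, y, hy, rfl⟩
    change a i ⬝ᵥ (x - y) = 0
    rw [dotProduct_sub, hx.2, hy.2, sub_self]
  · intro e he
    have he : a i ⬝ᵥ e = 0 := he
    obtain ⟨y, hy, hy'⟩ := h.exists_tight i
    have hyP : y ∈ polyhedron a c := fun j => by
      rcases eq_or_ne j i with rfl | hji
      · exact hy.le
      · exact (hy' j hji).le
    obtain ⟨t, ht, hmem, -⟩ := exists_mem_of_tight (e := e) hyP fun j hj => by
      rcases eq_or_ne j i with rfl | hji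
      · exact he
      · exact absurd hj (hy' j hji).ne
    have h1 : y + t • e ∈ face a c i := ⟨hmem, by simp [dotProduct_add, he, hy]⟩
    have h2 := vsub_mem_vectorSpan ℝ h1 ⟨hyP, hy⟩
    have h3 : t⁻¹ • ((y + t • e) -ᵥ y) = e := by
      rw [vsub_eq_sub, add_sub_cancel_left, smul_smul, inv_mul_cancel₀ ht.ne', one_smul]
    rw [← h3]
    exact Submodule.smul_mem _ _ h2

theorem Irredundant.finrank_vectorSpan_face [Finite ι] (h : Irredundant a c) (i : ι) :
    Module.finrank ℝ (vectorSpan ℝ (face a c i)) + 1 = d := by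
  obtain ⟨p, hp⟩ := h.exists_strict
  obtain ⟨y, hy, -⟩ := h.exists_tight i
  have hne : dotProductBilin ℝ ℝ (a i) ≠ 0 := by
    intro h0
    have h1 : a i ⬝ᵥ p = 0 := DFunLike.congr_fun h0 p
    have h2 : a i ⬝ᵥ y = 0 := DFunLike.congr_fun h0 y
    have := hp i
    linarith
  rw [h.vectorSpan_face, Module.Dual.finrank_ker_add_one_of_ne_zero hne, Module.finrank_fin_fun]

theorem Irredundant.exists_mem_face [Finite ι] (h : Irredundant a c) (i : ι) :
    ∃ y ∈ face a c i, ∀ j, j ≠ i → a j ⬝ᵥ y < c j := by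
  obtain ⟨y, hy, hy'⟩ := h.exists_tight i
  refine ⟨y, ⟨fun j => ?_, hy⟩, hy'⟩
  rcases eq_or_ne j i with rfl | hji
  · exact hy.le
  · exact (hy' j hji).le

theorem Irredundant.face_injective [Finite ι] (h : Irredundant a c) :
    Function.Injective (face a c) := by
  intro i j hij
  by_contra hne
  obtain ⟨y, hy, hy'⟩ := h.exists_mem_face i
  exact (hy' j (Ne.symm hne)).ne (hij ▸ hy : y ∈ face a c j).2

theorem Irredundant.face_mem_facets [Finite ι] (h : Irredundant a c) (i : ι) :
    face a c i ∈ facets (polyhedron a c) := by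
  obtain ⟨y, hy, -⟩ := h.exists_mem_face i
  refine ⟨⟨y, hy⟩, fun _ => ⟨LinearMap.toContinuousLinearMap (dotProductBilin ℝ ℝ (a i)), ?_⟩,
    by rw [h.finrank_vectorSpan_face, h.finrank_vectorSpan]⟩
  ext x
  refine ⟨fun hx => ⟨hx.1, fun z hz => ?_⟩, fun hx => ⟨hx.1, le_antisymm (hx.1 i) ?_⟩⟩
  · exact (hz i).trans hx.2.ge
  · exact hy.2.ge.trans (hx.2 y hy.1)

/-- A linear functional maximized at a strict solution of the system vanishes. -/
theorem eq_zero_of_forall_le [Finite ι] {x : Fin d → ℝ} (hx : ∀ i, a i ⬝ᵥ x < c i)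
    (l : StrongDual ℝ (Fin d → ℝ)) (hl : ∀ y ∈ polyhedron a c, l y ≤ l x) : l = 0 := by
  ext1 e
  obtain ⟨t, ht, h1, h2⟩ := exists_mem_of_tight (e := e) (fun i => (hx i).le)
    fun i hi => absurd hi (hx i).ne
  have h1 := hl _ h1
  have h2 := hl _ h2
  simp only [map_add, map_sub, map_smul, smul_eq_mul] at h1 h2
  have : t * l e = 0 := by linarith
  simpa [ht.ne'] using this

/-- Take one witness in `F` for each inequality; their barycentre satisfies all inequalities
strictly. -/
theorem exists_forall_lt [Fintype ι] [Nonempty ι] {F : Set (Fin d → ℝ)} (hF : Convex ℝ F)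
    (hFP : F ⊆ polyhedron a c) (hne : ∀ i, ∃ x ∈ F, a i ⬝ᵥ x ≠ c i) :
    ∃ x ∈ F, ∀ i, a i ⬝ᵥ x < c i := by
  choose z hzF hz using hne
  have hpos : (0 : ℝ) < (Fintype.card ι : ℝ)⁻¹ := inv_pos.2 (Nat.cast_pos.2 Fintype.card_pos)
  have hone : ∑ _i : ι, (Fintype.card ι : ℝ)⁻¹ = 1 := by
    simp [Finset.sum_const]
  refine ⟨∑ i, (Fintype.card ι : ℝ)⁻¹ • z i, hF.sum_mem (fun _ _ => hpos.le) hone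
    fun i _ => hzF i, fun j => ?_⟩
  calc a j ⬝ᵥ ∑ i, (Fintype.card ι : ℝ)⁻¹ • z i
      = ∑ i, (Fintype.card ι : ℝ)⁻¹ * (a j ⬝ᵥ z i) := by
        simp [dotProduct_sum, dotProduct_smul]
    _ < ∑ i : ι, (Fintype.card ι : ℝ)⁻¹ * c j := by
        refine Finset.sum_lt_sum
          (fun i _ => mul_le_mul_of_nonneg_left (hFP (hzF i) j) hpos.le)
          ⟨j, Finset.mem_univ j, mul_lt_mul_of_pos_left (lt_of_le_of_ne (hFP (hzF j) j) (hz j)) hpos⟩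
    _ = c j := by rw [← Finset.sum_mul, hone, one_mul]

/-- The facets of a polyhedron given by an irredundant system are the faces of the inequalities. -/
theorem Irredundant.facets_eq [Finite ι] (h : Irredundant a c) :
    facets (polyhedron a c) = Set.range (face a c) := by
  have := Fintype.ofFinite ι
  refine Set.Subset.antisymm ?_ (Set.range_subset_iff.2 h.face_mem_facets)
  rintro F ⟨hFne, hFexp, hdim⟩
  have hconv : Convex ℝ F := hFexp.convex convex_polyhedron
  obtain ⟨l, hl⟩ := hFexp hFne
  have hFP : F ⊆ polyhedron a c := hFexp.subset
  have hl0 : l ≠ 0 := by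
    rintro rfl
    have : F = polyhedron a c := by
      rw [hl]; ext; simp
    rw [this] at hdim
    omega
  -- If `F` lay in no single face, it would contain a strict solution; the exposing functional,
  -- maximal there, would vanish and `F` would be the whole polyhedron.
  obtain ⟨i, hi⟩ : ∃ i, ∀ x ∈ F, a i ⬝ᵥ x = c i := by
    by_contra! hcon
    rcases isEmpty_or_nonempty ι with hι | hι
    · obtain ⟨x, hx⟩ := hFne
      rw [hl] at hx
      exact hl0 (eq_zero_of_forall_le (x := x) (fun i => isEmptyElim i) l hx.2)
    · obtain ⟨x, hx, hx'⟩ := exists_forall_lt hconv hFP hcon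
      rw [hl] at hx
      exact hl0 (eq_zero_of_forall_le hx' l hx.2)
  have hsub : F ⊆ face a c i := fun x hx => ⟨hFP hx, hi x hx⟩
  have hspan : vectorSpan ℝ F = vectorSpan ℝ (face a c i) := by
    refine Submodule.eq_of_le_of_finrank_eq (vectorSpan_mono ℝ hsub) ?_
    have h1 := h.finrank_vectorSpan_face i
    rw [h.finrank_vectorSpan] at hdim
    omega
  refine ⟨i, Set.Subset.antisymm (fun x hx => ?_) hsub⟩
  obtain ⟨x₀, hx₀⟩ := hFne
  have hmem : x - x₀ ∈ vectorSpan ℝ F := hspan ▸ vsub_mem_vectorSpan ℝ hx (hsub hx₀)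
  -- The exposing functional is constant on `F`, hence along the span that `F` shares with the face,
  -- so every point of the face is a maximizer too.
  have hker : vectorSpan ℝ F ≤ LinearMap.ker l.toLinearMap := by
    refine Submodule.span_le.2 ?_
    rintro _ ⟨y, hy, z, hz, rfl⟩
    rw [hl] at hy hz
    change l (y - z) = 0
    rw [map_sub, sub_eq_zero]
    exact le_antisymm (hz.2 y hy.1) (hy.2 z hz.1)
  have hlx : l (x - x₀) = 0 := hker hmem
  rw [map_sub, sub_eq_zero] at hlx
  rw [hl] at hx₀ ⊢
  exact ⟨hx.1, fun y hy => hlx ▸ hx₀.2 y hy⟩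

theorem Irredundant.encard_facets [Fintype ι] (h : Irredundant a c) :
    (facets (polyhedron a c)).encard = Fintype.card ι := by
  rw [h.facets_eq, ← Set.image_univ, h.face_injective.encard_image, Set.encard_univ,
    ENat.card_eq_coe_fintype_card]

/-- The region bounded by some of the facets is given by the corresponding inequalities. -/
theorem Irredundant.boundedBy_image_face [Finite ι] (h : Irredundant a c) (J : Set ι) :
    boundedBy (polyhedron a c) (face a c '' J) = {x | ∀ i ∈ J, a i ⬝ᵥ x ≤ c i} := by
  ext x
  constructor
  · intro hx i hi
    exact hx _ ⟨i, hi, rfl⟩ (a i) (c i) (fun y hy => hy i) fun y hy => hy.2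
  · rintro hx _ ⟨i, hi, rfl⟩ w r hw hwF
    obtain ⟨y, hy, -⟩ := h.exists_mem_face i
    obtain ⟨p, hp⟩ := h.exists_strict
    -- A supporting hyperplane that contains a facet is the facet's own plane: `w` is a multiple of
    -- `a i`. Comparison with the strict solution `p` shows that the multiple is non-negative.
    have hker : ∀ e, a i ⬝ᵥ e = 0 → w ⬝ᵥ e = 0 := by
      intro e he
      have he' : e ∈ vectorSpan ℝ (face a c i) := by
        rw [h.vectorSpan_face]; exact he
      have hle : vectorSpan ℝ (face a c i) ≤ LinearMap.ker (dotProductBilin ℝ ℝ w) := by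
        refine Submodule.span_le.2 ?_
        rintro _ ⟨y, hy, z, hz, rfl⟩
        change w ⬝ᵥ (y - z) = 0
        rw [dotProduct_sub, hwF y hy, hwF z hz, sub_self]
      exact hle he'
    have hx' := hx i hi
    have hap : a i ⬝ᵥ (y - p) > 0 := by
      rw [dotProduct_sub, hy.2]; exact sub_pos.2 (hp i)
    have h1 := hker ((a i ⬝ᵥ (y - p)) • (y - x) - (a i ⬝ᵥ (y - x)) • (y - p)) (by
      simp only [dotProduct_sub, dotProduct_smul, smul_eq_mul]; ring)
    rw [dotProduct_sub, dotProduct_smul, dotProduct_smul, smul_eq_mul, smul_eq_mul, sub_eq_zero] at h1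
    have h2 : 0 ≤ a i ⬝ᵥ (y - x) := by
      rw [dotProduct_sub, hy.2]; exact sub_nonneg.2 hx'
    have h3 : 0 ≤ w ⬝ᵥ (y - p) := by
      rw [dotProduct_sub, hwF y hy]; exact sub_nonneg.2 (hw p fun i => (hp i).le)
    have h4 : 0 ≤ w ⬝ᵥ (y - x) := by
      by_contra! hneg
      have := mul_neg_of_pos_of_neg hap hneg
      have := mul_nonneg h2 h3
      linarith
    rw [dotProduct_sub, hwF y hy] at h4
    linarith

/-- A full-dimensional polyhedron is given by an irredundant subsystem. -/
theorem exists_irredundant_subsystem [Finite ι] (hint : (interior (polyhedron a c)).Nonempty) :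
    ∃ J : Finset ι, polyhedron (fun i : J => a i) (fun i : J => c i) = polyhedron a c ∧
      Irredundant (fun i : J => a i) (fun i : J => c i) := by
  classical
  have := Fintype.ofFinite ι
  obtain ⟨J, hJ, hmin⟩ := exists_minimal_of_wellFoundedLT
    (fun J : Finset ι => polyhedron (fun i : J => a i) (fun i : J => c i) = polyhedron a c)
    ⟨Finset.univ, by ext x; simp [polyhedron]⟩
  refine ⟨J, hJ, ?_⟩
  -- By minimality of `J`, dropping the inequality `i` enlarges the solution set.
  have hviol : ∀ i ∈ J, ∃ x, c i < a i ⬝ᵥ x ∧ ∀ j ∈ J, j ≠ i → a j ⬝ᵥ x ≤ c j := by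
    intro i hi
    by_contra! hcon
    have hP : polyhedron (fun j : J.erase i => a j) (fun j : J.erase i => c j) = polyhedron a c := by
      rw [← hJ]
      refine Set.Subset.antisymm (fun x hx => ?_) fun x hx j => hx ⟨j, Finset.mem_of_mem_erase j.2⟩
      have hx' : ∀ j ∈ J, j ≠ i → a j ⬝ᵥ x ≤ c j := fun j hj hji =>
        hx ⟨j, Finset.mem_erase.2 ⟨hji, hj⟩⟩
      rintro ⟨j, hj⟩
      by_contra! hlt
      rcases eq_or_ne j i with rfl | hji
      · obtain ⟨k, hk, hkj, hlt'⟩ := hcon x hlt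
        exact absurd (hx' k hk hkj) (not_le.2 hlt')
      · exact absurd (hx' j hj hji) (not_le.2 hlt)
    exact Finset.notMem_erase i J (hmin hP (Finset.erase_subset i J) hi)
  obtain ⟨p, hp⟩ := hint
  have hpP : p ∈ polyhedron a c := interior_subset hp
  have hstrict : ∀ i ∈ J, a i ⬝ᵥ p < c i := by
    intro i hi
    refine lt_of_le_of_ne (hpP i) fun heq => ?_
    obtain ⟨x, hx, -⟩ := hviol i hi
    have hcont : Filter.Tendsto (fun t : ℝ => p + t • (x - p)) (nhdsWithin 0 (Set.Ioi 0)) (nhds p) := by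
      have hc : Continuous (fun t : ℝ => p + t • (x - p)) := by fun_prop
      have h0 := hc.tendsto 0
      rw [zero_smul, add_zero] at h0
      exact h0.mono_left nhdsWithin_le_nhds
    obtain ⟨t, ht, ht0⟩ := ((hcont.eventually (mem_interior_iff_mem_nhds.1 hp)).and
      self_mem_nhdsWithin).exists
    have h1 : a i ⬝ᵥ (p + t • (x - p)) ≤ c i := ht i
    have h2 : 0 < t * (a i ⬝ᵥ x - a i ⬝ᵥ p) := mul_pos ht0 (by linarith)
    simp only [dotProduct_add, dotProduct_sub, dotProduct_smul, smul_eq_mul] at h1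
    linarith
  refine ⟨⟨p, fun i => hstrict i i.2⟩, ?_⟩
  rintro ⟨i, hi⟩
  obtain ⟨x, hx, hx'⟩ := hviol i hi
  have hpi := hstrict i hi
  have hden : 0 < a i ⬝ᵥ x - a i ⬝ᵥ p := by linarith
  -- The parameter at which the segment from `p` to `x` crosses the `i`-th hyperplane; there the
  -- other inequalities are still strict, since they are strict at `p` and hold at `x`.
  set t := (c i - a i ⬝ᵥ p) / (a i ⬝ᵥ x - a i ⬝ᵥ p) with ht
  have ht0 : 0 < t := div_pos (by linarith) hden
  have ht1 : t < 1 := (div_lt_one hden).2 (by linarith)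
  refine ⟨p + t • (x - p), ?_, ?_⟩
  · simp only [dotProduct_add, dotProduct_sub, dotProduct_smul, smul_eq_mul]
    rw [ht, div_mul_cancel₀ _ hden.ne']
    ring
  · rintro ⟨j, hj⟩ hji
    have hji' : j ≠ i := fun h => hji (Subtype.ext h)
    have h1 := mul_le_mul_of_nonneg_left (hx' j hj hji') ht0.le
    have h2 := mul_lt_mul_of_pos_left (hstrict j hj) (sub_pos.2 ht1)
    simp only [dotProduct_add, dotProduct_sub, dotProduct_smul, smul_eq_mul]
    linarith

/-- A bounded full-dimensional polyhedron in `ℝ³` given by `f` inequalities has at most `2 f - 4`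
vertices. -/
theorem encard_extremePoints_add_four_le [Fintype ι] {a : ι → Fin 3 → ℝ}
    (hint : (interior (polyhedron a c)).Nonempty) (hb : Bornology.IsBounded (polyhedron a c)) :
    ((polyhedron a c).extremePoints ℝ).encard + 4 ≤ 2 * (Fintype.card ι : ℕ∞) := by
  obtain ⟨J, hJ, hirr⟩ := exists_irredundant_subsystem hint
  have h1 := hirr.encard_extremePoints_add_four_le (hJ.symm ▸ hb)
  rw [hJ, Fintype.card_coe] at h1
  refine h1.trans ?_
  gcongr
  exact Finset.card_le_univ J

/-- Finiteness of the set of facets, and the relation between the numbers of facets and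
vertices. -/
theorem facets_finite_and_encard_le {X : Set (Fin 3 → ℝ)} (hX : IsFullPolytope X) :
    (facets X).Finite ∧ (X.extremePoints ℝ).encard + 4 ≤ 2 * (facets X).encard := by
  obtain ⟨⟨H, hH, rfl⟩, hb, hint⟩ := hX
  have : Finite H := hH
  have hP : {x | ∀ h ∈ H, h.1 ⬝ᵥ x ≤ h.2} = polyhedron (fun h : H => h.1.1) fun h : H => h.1.2 := by
    ext x; simp [polyhedron]
  rw [hP] at hb hint ⊢
  obtain ⟨J, hJ, hirr⟩ := exists_irredundant_subsystem hint
  rw [← hJ] at hb ⊢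
  refine ⟨?_, ?_⟩
  · rw [hirr.facets_eq]; exact Set.finite_range _
  · rw [hirr.encard_facets]; exact hirr.encard_extremePoints_add_four_le hb

end Halfspaces

namespace Benson

open Halfspaces

/-! ### Homogeneous coordinates and cross-sections -/

variable {p m n : ℕ}

/-- The cross-section of the cone `region H` by the hyperplane on which the coordinates add up to
`1`, parametrized by the first `p` coordinates. -/
def crossSection (H : Set (Homog p)) : Set (Fin p → ℝ) :=
  -- The coefficients arise by substituting `1 - ∑ i, y i` for the last coordinate in `side`.
  polyhedron (fun (h : H) i => h.1.2 - h.1.1 i) fun h : H => h.1.2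

/-- The sum of the coordinates. -/
def total (z : Homog p) : ℝ := ∑ i, z.1 i + z.2

/-- The region bounded by `H` lies in the non-negative orthant. -/
def RegionNonneg (H : Set (Homog p)) : Prop := ∀ z ∈ region H, 0 ≤ z.1 ∧ 0 ≤ z.2

theorem side_smul (h z : Homog p) (t : ℝ) : side h (t • z) = t * side h z := by
  simp only [side, Prod.smul_fst, Prod.smul_snd, smul_dotProduct, smul_eq_mul]; ring

theorem smul_mem_region {H : Set (Homog p)} {z : Homog p} (hz : z ∈ region H) {t : ℝ}
    (ht : 0 ≤ t) : t • z ∈ region H := fun h hh => by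
  rw [side_smul]; exact mul_nonneg ht (hz h hh)

theorem total_add (z z' : Homog p) : total (z + z') = total z + total z' := by
  simp only [total, Prod.fst_add, Prod.snd_add, Pi.add_apply, Finset.sum_add_distrib]; ring

theorem side_eq (h : Homog p) (y : Fin p → ℝ) :
    side h (y, 1 - ∑ i, y i) = h.2 - (fun i => h.2 - h.1 i) ⬝ᵥ y := by
  simp only [side, dotProduct, sub_mul, Finset.sum_sub_distrib, ← Finset.mul_sum]
  simp only [mul_comm (y _)]
  ring

theorem mem_crossSection {H : Set (Homog p)} {y : Fin p → ℝ} :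
    y ∈ crossSection H ↔ (y, 1 - ∑ i, y i) ∈ region H := by
  simp only [crossSection, polyhedron, region, Set.mem_ofPred_eq, side_eq, sub_nonneg,
    Subtype.forall]

theorem smul_lift {z : Homog p} (hz : total z ≠ 0) :
    (((total z)⁻¹ • z.1, 1 - ∑ i, ((total z)⁻¹ • z.1) i) : Homog p) = (total z)⁻¹ • z := by
  refine Prod.ext rfl ?_
  simp only [Pi.smul_apply, smul_eq_mul, ← Finset.mul_sum, Prod.smul_snd]
  field_simp
  simp [total]

theorem total_lift (y : Fin p → ℝ) : total ((y, 1 - ∑ i, y i) : Homog p) = 1 := by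
  simp [total]

theorem inv_total_smul_mem {H : Set (Homog p)} {z : Homog p} (hz : z ∈ region H)
    (ht : 0 < total z) : (total z)⁻¹ • z.1 ∈ crossSection H := by
  rw [mem_crossSection, smul_lift ht.ne']
  exact smul_mem_region hz (inv_pos.2 ht).le

theorem RegionNonneg.total_nonneg {H : Set (Homog p)} (hH : RegionNonneg H) {z : Homog p}
    (hz : z ∈ region H) : 0 ≤ total z :=
  add_nonneg (Finset.sum_nonneg fun i _ => (hH z hz).1 i) (hH z hz).2

theorem RegionNonneg.eq_zero {H : Set (Homog p)} (hH : RegionNonneg H) {z : Homog p}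
    (hz : z ∈ region H) (h0 : total z = 0) : z = 0 := by
  have h1 := Finset.sum_nonneg fun i (_ : i ∈ Finset.univ) => (hH z hz).1 i
  have h2 := (hH z hz).2
  unfold total at h0
  refine Prod.ext (funext fun i => ?_) (by simp only [Prod.snd_zero]; linarith)
  exact (Finset.sum_eq_zero_iff_of_nonneg fun i _ => (hH z hz).1 i).1 (by linarith) i
    (Finset.mem_univ i)

theorem RegionNonneg.isBounded_crossSection {H : Set (Homog p)} (hH : RegionNonneg H) :
    Bornology.IsBounded (crossSection H) := by
  refine (Metric.isBounded_Icc (0 : Fin p → ℝ) 1).subset fun y hy => ?_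
  obtain ⟨h1, h2⟩ := hH _ (mem_crossSection.1 hy)
  refine ⟨h1, fun i => ?_⟩
  have h3 := Finset.single_le_sum (f := y) (fun i _ => h1 i) (Finset.mem_univ i)
  simp only [sub_nonneg] at h2
  exact h3.trans h2

theorem Normalized.total_pos {H : Set (Homog p)} (hH : RegionNonneg H) {z : Homog p}
    (hn : Normalized z) (hz : z ∈ region H) : 0 < total z := by
  have h1 := Finset.sum_nonneg fun i (_ : i ∈ Finset.univ) => (hH z hz).1 i
  unfold total
  rcases hn with h | ⟨h, h'⟩ <;> linarith

/-- Makes the correspondence between vertices and rays injective: a normalized vector is the only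
one on its line. -/
theorem Normalized.eq_of_smul {z z' : Homog p} {t : ℝ} (hz : Normalized z) (hz' : Normalized z')
    (h : z' = t • z) : z' = z := by
  subst h
  rcases hz with h | ⟨h, h1⟩ <;> rcases hz' with h' | ⟨h', h1'⟩
  · have : t = 1 := by simpa [h] using h'
    rw [this, one_smul]
  · have : t = 0 := by simpa [h] using h'
    simp [this] at h1'
  · simp [h] at h'
  · have : t = 1 := by simpa [← Finset.mul_sum, h1] using h1'
    rw [this, one_smul]

/-- The vertices of the polytope bounded by `H` correspond to extreme points of the cross-section. -/
theorem RegionNonneg.encard_vertices_le {H : Set (Homog p)} (hH : RegionNonneg H) :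
    (vertices H).encard ≤ ((crossSection H).extremePoints ℝ).encard := by
  refine Set.encard_le_encard_of_injOn (f := fun z => (total z)⁻¹ • z.1) ?_ ?_
  · rintro z ⟨hn, hz, hext⟩
    have ht := Normalized.total_pos hH hn hz
    refine ⟨inv_total_smul_mem hz ht, fun y₁ hy₁ y₂ hy₂ hy => ?_⟩
    obtain ⟨r, s, hr, hs, hrs, hsum⟩ := hy
    have h1 := smul_mem_region (mem_crossSection.1 hy₁) (mul_pos ht hr).le
    have h2 := smul_mem_region (mem_crossSection.1 hy₂) (mul_pos ht hs).le
    have hz1 : z.1 = total z • (r • y₁ + s • y₂) := by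
      rw [hsum, smul_smul, mul_inv_cancel₀ ht.ne', one_smul]
    obtain ⟨t, htz⟩ := hext _ h1 _ h2 (by
      refine Prod.ext ?_ ?_
      · rw [hz1]; simp [smul_smul, smul_add]
      · have h3 : ∑ i, z.1 i = total z * (r * ∑ i, y₁ i + s * ∑ i, y₂ i) := by
          rw [hz1]; simp [Finset.sum_add_distrib, ← Finset.mul_sum]
        have h4 : total z = ∑ i, z.1 i + z.2 := rfl
        simp only [Prod.snd_add, Prod.smul_snd, smul_eq_mul]
        have h5 : s = 1 - r := by linarith
        subst h5
        linarith)
    have hy₁z : ((y₁, 1 - ∑ i, y₁ i) : Homog p) = ((total z * r)⁻¹ * t) • z := by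
      rw [mul_smul, ← htz, smul_smul, inv_mul_cancel₀ (mul_pos ht hr).ne', one_smul]
    -- Comparing coordinate sums determines the factor of proportionality.
    have hscal : 1 = ((total z * r)⁻¹ * t) * total z := by
      have h6 := congrArg total hy₁z
      rw [total_lift] at h6
      rw [h6]
      simp only [total, Prod.smul_fst, Prod.smul_snd, Pi.smul_apply, smul_eq_mul, ← Finset.mul_sum]
      ring
    change y₁ = (total z)⁻¹ • z.1
    rw [← eq_inv_of_mul_eq_one_left hscal.symm]
    exact congrArg Prod.fst hy₁z
  · rintro z ⟨hn, hz, -⟩ z' ⟨hn', hz', -⟩ heq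
    have ht := Normalized.total_pos hH hn hz
    have ht' := Normalized.total_pos hH hn' hz'
    have h1 := smul_lift ht.ne'
    have h2 := smul_lift ht'.ne'
    simp only at heq
    rw [heq, h2] at h1
    refine Normalized.eq_of_smul (t := total z * (total z')⁻¹) hn' hn ?_
    rw [mul_smul, h1, smul_smul, mul_inv_cancel₀ ht.ne', one_smul]

/-- If the polytope bounded by `H` contains an ordinary point, it has an ordinary vertex. -/
theorem RegionNonneg.exists_vertex {H : Set (Homog p)} (hH : RegionNonneg H) {q : Fin p → ℝ}
    (hq : (q, 1) ∈ region H) : ∃ y, (y, 1) ∈ vertices H := by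
  have htq : 0 < total ((q, 1) : Homog p) := Normalized.total_pos hH (Or.inl rfl) hq
  have hcomp : IsCompact (crossSection H) :=
    Metric.isCompact_of_isClosed_isBounded isClosed_polyhedron hH.isBounded_crossSection
  -- Minimizing the sum of the first `p` coordinates maximizes the last one. The section contains a
  -- multiple of `(q, 1)`, so the last coordinate is positive at the optimum and the vertex is
  -- ordinary.
  obtain ⟨v, hv, -, hmax⟩ := exists_extremePoint_forall_le hcomp
    ⟨_, inv_total_smul_mem hq htq⟩ IsExtreme.rfl (fun _ => -1)
  have hvs : ∑ i, v i < 1 := by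
    have h1 := hmax _ (inv_total_smul_mem hq htq)
    have h2 := congrArg Prod.snd (smul_lift htq.ne')
    have h3 := inv_pos.2 htq
    simp only [dotProduct, neg_mul, one_mul, Finset.sum_neg_distrib, neg_le_neg_iff] at h1
    simp only [Prod.smul_snd, smul_eq_mul, mul_one] at h2
    linarith
  have hpos : 0 < 1 - ∑ i, v i := by linarith
  have hz : (((1 - ∑ i, v i)⁻¹ • v, 1) : Homog p) = (1 - ∑ i, v i)⁻¹ • (v, 1 - ∑ i, v i) := by
    refine Prod.ext rfl ?_
    simp [hpos.ne']
  refine ⟨(1 - ∑ i, v i)⁻¹ • v, Or.inl rfl, ?_, fun z₁ hz₁ z₂ hz₂ hsum => ?_⟩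
  · rw [hz]; exact smul_mem_region (mem_crossSection.1 hv.1) (inv_pos.2 hpos).le
  · rcases (hH.total_nonneg hz₁).eq_or_lt with h1 | h1
    · exact ⟨0, by rw [hH.eq_zero hz₁ h1.symm, zero_smul]⟩
    rcases (hH.total_nonneg hz₂).eq_or_lt with h2 | h2
    · exact ⟨1, by rw [one_smul, ← hsum, hH.eq_zero hz₂ h2.symm, add_zero]⟩
    have htot : total z₁ + total z₂ = (1 - ∑ i, v i)⁻¹ := by
      rw [← total_add, hsum, hz]
      simp only [total, Prod.smul_fst, Prod.smul_snd, Pi.smul_apply, smul_eq_mul, ← Finset.mul_sum]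
      ring
    have hvsum : v = (1 - ∑ i, v i) • z₁.1 + (1 - ∑ i, v i) • z₂.1 := by
      have h3 := congrArg Prod.fst hsum
      simp only [Prod.fst_add] at h3
      rw [← smul_add, h3, smul_smul, mul_inv_cancel₀ hpos.ne', one_smul]
    have h3 : (total z₁)⁻¹ • z₁.1 = v := by
      refine hv.2 (inv_total_smul_mem hz₁ h1) (inv_total_smul_mem hz₂ h2)
        ⟨(1 - ∑ i, v i) * total z₁, (1 - ∑ i, v i) * total z₂, mul_pos hpos h1, mul_pos hpos h2,
          by rw [← mul_add, htot, mul_inv_cancel₀ hpos.ne'], ?_⟩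
      rw [mul_smul, mul_smul, smul_smul (total z₁), smul_smul (total z₂),
        mul_inv_cancel₀ h1.ne', mul_inv_cancel₀ h2.ne', one_smul, one_smul]
      exact hvsum.symm
    have h4 := smul_lift h1.ne'
    rw [h3] at h4
    refine ⟨total z₁ * (1 - ∑ i, v i), ?_⟩
    rw [hz, smul_smul, mul_assoc, mul_inv_cancel₀ hpos.ne', mul_one, h4, smul_smul,
      mul_inv_cancel₀ h1.ne', one_smul]

/-- A polytope with an interior point, bounded by `f` planes of the extended space, has at most
`2 f - 4` vertices. -/
theorem RegionNonneg.encard_vertices_add_four_le {H : Set (Homog 3)} (hH : RegionNonneg H)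
    (hfin : H.Finite) {q : Fin 3 → ℝ} (hq : ∀ h ∈ H, 0 < side h (q, 1)) :
    (vertices H).encard + 4 ≤ 2 * H.encard := by
  have : Fintype H := hfin.fintype
  have hqr : (q, 1) ∈ region H := fun h hh => (hq h hh).le
  have htq : 0 < total ((q, 1) : Homog 3) := Normalized.total_pos hH (Or.inl rfl) hqr
  have hint : (interior (crossSection H)).Nonempty := by
    refine interior_polyhedron_nonempty (p := (total ((q, 1) : Homog 3))⁻¹ • q) fun h => ?_
    rw [← sub_pos, ← side_eq]
    have h1 := smul_lift htq.ne'
    simp only at h1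
    rw [h1, side_smul]
    exact mul_pos (inv_pos.2 htq) (hq h h.2)
  have h2 := encard_extremePoints_add_four_le hint hH.isBounded_crossSection
  have h3 : H.encard = Fintype.card H := ENat.card_eq_coe_fintype_card
  rw [h3]
  exact (add_le_add_left hH.encard_vertices_le 4).trans h2

end Benson

namespace Benson

open Halfspaces

variable {p m n : ℕ}

/-! ### Runs of the algorithm -/

theorem mem_region_initial {z : Homog p} (hz : z ∈ region (initial p).planes) :
    0 ≤ z.1 ∧ 0 ≤ z.2 := by
  refine ⟨fun i => ?_, ?_⟩
  · have := hz (Pi.single i 1, 0) (Or.inr ⟨i, rfl⟩)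
    simpa [side] using this
  · have := hz (0, 1) (Or.inl rfl)
    simpa [side] using this

theorem regionNonneg_of_initial_subset {H : Set (Homog p)} (hH : (initial p).planes ⊆ H) :
    RegionNonneg H := fun _ hz => mem_region_initial fun h hh => hz h (hH hh)

theorem origin_mem_vertices_initial : ((0, 1) : Homog p) ∈ vertices (initial p).planes := by
  refine ⟨Or.inl rfl, ?_, fun z₁ hz₁ z₂ hz₂ hsum => ⟨z₁.2, ?_⟩⟩
  · rintro h (rfl | ⟨i, rfl⟩) <;> simp [side]
  · have h1 := (mem_region_initial hz₁).1
    have h2 := (mem_region_initial hz₂).1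
    have h3 := congrArg Prod.fst hsum
    refine Prod.ext (funext fun i => ?_) (by simp)
    have h4 : z₁.1 i + z₂.1 i = 0 := congrFun h3 i
    have h5 : 0 ≤ z₁.1 i := h1 i
    have h6 : 0 ≤ z₂.1 i := h2 i
    simp only [Prod.smul_fst, Pi.smul_apply, Pi.zero_apply, smul_zero]
    linarith

theorem encard_range_single_le (c : Fin p → Homog p) : (Set.range c).encard ≤ p := by
  rw [← Set.image_univ]
  refine (Set.encard_image_le _ _).trans ?_
  simp

/-- Coordinate projections are open maps, and they send 𝒬⁺ into `[0, ∞)`. Hence `q` lies strictly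
inside the initial simplex. -/
theorem pos_of_mem_interior_Qplus {D : Problem p m n} {q : Fin p → ℝ}
    (hQ : ∀ y ∈ D.Q, 0 ≤ y) (hq : q ∈ interior D.Qplus) (i : Fin p) : 0 < q i := by
  have hopen : IsOpen ((fun y : Fin p → ℝ => y i) '' interior D.Qplus) :=
    isOpenMap_eval i _ isOpen_interior
  have hsub : (fun y : Fin p → ℝ => y i) '' interior D.Qplus ⊆ Set.Ici 0 := by
    rintro _ ⟨y, hy, rfl⟩
    obtain ⟨y', hy', hle⟩ := interior_subset hy
    exact (hQ y' hy' i).trans (hle i)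
  have := interior_maximal hsub hopen ⟨q, hq, rfl⟩
  simpa [interior_Ici] using this

/-- An iteration either adds a hyperplane or marks a further point. -/
theorem Step.cases_cut_or_mark {D : Problem p m n} {q : Fin p → ℝ} {s t : State p}
    (h : Step D q s t) :
    (t.marked = s.marked ∧ ∃ g, 0 < side g (q, 1) ∧ t.planes = insert g s.planes) ∨
    (t.marked ≠ s.marked ∧ t.planes = s.planes ∧ ∃ y, 1 ∈ D.primalValues q (q - y) ∧
      t.marked = insert (y, 1) s.marked) := by
  cases h with
  | mark y vertex unmarked optimum =>
    refine Or.inr ⟨fun h => unmarked ?_, rfl, y, optimum.1, rfl⟩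
    rw [← h]
    exact Set.mem_insert _ _
  | cut y lam u v vertex unmarked optimum pos lt_one dual value =>
    refine Or.inl ⟨rfl, _, ?_, rfl⟩
    -- By the dual normalization the new plane takes the value `lam > 0` at `q`, so `q` remains an
    -- interior point.
    have h1 : q ⬝ᵥ v - y ⬝ᵥ v = 1 := by rw [← sub_dotProduct]; exact dual.2.1
    simp only [side, sub_dotProduct, smul_dotProduct, smul_eq_mul]
    rw [h1]
    linarith

open Classical in
/-- The number of cuts among the first `i` iterations. -/
noncomputable def cuts (σ : ℕ → State p) (i : ℕ) : ℕ :=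
  -- A marking step changes the marked set, because the selected vertex was unmarked, and a cut does
  -- not; so the states reveal the kind of each step.
  ((Finset.range i).filter fun j => (σ (j + 1)).marked = (σ j).marked).card

theorem cuts_succ_of_eq {σ : ℕ → State p} {i : ℕ} (h : (σ (i + 1)).marked = (σ i).marked) :
    cuts σ (i + 1) = cuts σ i + 1 := by
  rw [cuts, Finset.range_add_one, Finset.filter_insert, if_pos h, Finset.card_insert_of_notMem]
  · rfl
  · simp

theorem cuts_succ_of_ne {σ : ℕ → State p} {i : ℕ} (h : (σ (i + 1)).marked ≠ (σ i).marked) :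
    cuts σ (i + 1) = cuts σ i := by
  rw [cuts, Finset.range_add_one, Finset.filter_insert, if_neg h]
  rfl

/-- Invariants of a run after `i` iterations. -/
structure Invariant (D : Problem p m n) (q : Fin p → ℝ) (σ : ℕ → State p) (i : ℕ) : Prop where
  initial_subset : (initial p).planes ⊆ (σ i).planes
  side_pos : ∀ h ∈ (σ i).planes, 0 < side h (q, 1)
  cuts_le : cuts σ i ≤ i
  encard_planes_le : (σ i).planes.encard ≤ ((p + 1 + cuts σ i : ℕ) : ℕ∞)
  encard_marked_le : (σ i).marked.encard ≤ ((p + (i - cuts σ i) : ℕ) : ℕ∞)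
  -- The two extreme cases, no cut and nothing but cuts, are kept in order to exclude them for
  -- complete runs.
  planes_of_cuts_eq_zero : cuts σ i = 0 → (σ i).planes = (initial p).planes
  marked_of_cuts_eq : cuts σ i = i → (σ i).marked = (initial p).marked
  primal_of_marked : ∀ y, (y, 1) ∈ (σ i).marked → 1 ∈ D.primalValues q (q - y)

theorem not_ordinary_mem_initial_marked (y : Fin p → ℝ) : (y, 1) ∉ (initial p).marked := by
  rintro ⟨i, hi⟩
  exact zero_ne_one (congrArg Prod.snd hi)

theorem IsRun.invariant {D : Problem p m n} {q : Fin p → ℝ} {N : ℕ} {σ : ℕ → State p}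
    (hq : ∀ i, 0 < q i) (h : IsRun D q N σ) {i : ℕ} (hi : i ≤ N) : Invariant D q σ i := by
  induction i with
  | zero =>
    have h0 : cuts σ 0 = 0 := by simp [cuts]
    refine ⟨?_, ?_, h0.le, ?_, ?_, fun _ => ?_, fun _ => ?_, fun y hy => ?_⟩
    · rw [h.1]
    · rw [h.1]
      rintro g (rfl | ⟨j, rfl⟩)
      · simp [side]
      · simpa [side] using hq j
    · rw [h.1, h0]
      refine (Set.encard_insert_le _ _).trans ?_
      push_cast
      simpa using encard_range_single_le _
    · rw [h.1, h0]
      exact encard_range_single_le _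
    · rw [h.1]
    · rw [h.1]
    · rw [h.1] at hy
      exact absurd hy (not_ordinary_mem_initial_marked y)
  | succ i ih =>
    have ih := ih (Nat.le_of_succ_le hi)
    have hle := ih.cuts_le
    rcases (h.2.1 i hi).cases_cut_or_mark with ⟨hm, g, hg, hp⟩ | ⟨hm, hp, y, hy, hmy⟩
    · have hc := cuts_succ_of_eq hm
      refine ⟨?_, ?_, by omega, ?_, ?_, fun h0 => by omega, fun h1 => ?_, ?_⟩
      · rw [hp]; exact ih.initial_subset.trans (Set.subset_insert _ _)
      · rw [hp]
        rintro g' (rfl | hg')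
        · exact hg
        · exact ih.side_pos g' hg'
      · rw [hp, hc]
        refine (Set.encard_insert_le _ _).trans ((add_le_add_left ih.encard_planes_le 1).trans ?_)
        norm_cast
      · rw [hm, hc, Nat.add_sub_add_right]; exact ih.encard_marked_le
      · rw [hm]; exact ih.marked_of_cuts_eq (by omega)
      · rw [hm]; exact ih.primal_of_marked
    · have hc := cuts_succ_of_ne hm
      refine ⟨?_, ?_, by omega, ?_, ?_, fun h0 => ?_, fun h1 => by omega, ?_⟩
      · rw [hp]; exact ih.initial_subset
      · rw [hp]; exact ih.side_pos
      · rw [hp, hc]; exact ih.encard_planes_le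
      · rw [hmy, hc]
        refine (Set.encard_insert_le _ _).trans
          ((add_le_add_left ih.encard_marked_le 1).trans ?_)
        norm_cast
        omega
      · rw [hp]; exact ih.planes_of_cuts_eq_zero (by omega)
      · rw [hmy]
        rintro y' (hy' | hy')
        · rwa [show y' = y from congrArg Prod.fst hy']
        · exact ih.primal_of_marked y' hy'

/-- Between two moments with the same number of cuts only markings occur, and these leave the
polytope unchanged. -/
theorem IsRun.cuts_mono {D : Problem p m n} {q : Fin p → ℝ} {N : ℕ} {σ : ℕ → State p}
    (h : IsRun D q N σ) {i j : ℕ} (hij : i ≤ j) (hj : j ≤ N) :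
    cuts σ i ≤ cuts σ j ∧ (cuts σ i = cuts σ j → (σ j).planes = (σ i).planes) := by
  induction j, hij using Nat.le_induction with
  | base => exact ⟨le_rfl, fun _ => rfl⟩
  | succ j hij ih =>
    have ih := ih (Nat.le_of_succ_le hj)
    rcases (h.2.1 j hj).cases_cut_or_mark with ⟨hm, -⟩ | ⟨hm, hp, -⟩
    · have := cuts_succ_of_eq hm
      exact ⟨by omega, fun h => by omega⟩
    · rw [cuts_succ_of_ne hm, hp]
      exact ih

/-- Without cuts the origin stays a vertex and ends up marked. Then some feasible `x` has `P x ≤ 0`,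
and as 𝒬 is non-negative this puts the origin in 𝒬. -/
theorem IsRun.one_le_cuts {D : Problem p m n} {q : Fin p → ℝ} {N : ℕ} {σ : ℕ → State p}
    (hQ : ∀ y ∈ D.Q, 0 ≤ y) (h0 : (0 : Fin p → ℝ) ∉ D.Q) (hq : ∀ i, 0 < q i)
    (h : IsRun D q N σ) : 1 ≤ cuts σ N := by
  by_contra! hlt
  have hI := h.invariant hq le_rfl
  have hplanes := hI.planes_of_cuts_eq_zero (by omega)
  have hmem := h.2.2 (hplanes ▸ origin_mem_vertices_initial)
  obtain ⟨x, hx, hle⟩ := hI.primal_of_marked 0 hmem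
  have hxQ : D.P *ᵥ x ∈ D.Q := ⟨x, hx, rfl⟩
  rw [one_smul, sub_zero, sub_self] at hle
  exact h0 (le_antisymm hle (hQ _ hxQ) ▸ hxQ)

/-- The final polytope contains `q` and so has an ordinary vertex, whereas all initially marked
points are ideal. -/
theorem IsRun.cuts_lt {D : Problem p m n} {q : Fin p → ℝ} {N : ℕ} {σ : ℕ → State p}
    (hq : ∀ i, 0 < q i) (h : IsRun D q N σ) : cuts σ N < N := by
  have hI := h.invariant hq le_rfl
  refine lt_of_le_of_ne hI.cuts_le fun heq => ?_
  obtain ⟨y, hy⟩ := (regionNonneg_of_initial_subset hI.initial_subset).exists_vertex (q := q)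
    fun g hg => (hI.side_pos g hg).le
  have := h.2.2 hy
  rw [hI.marked_of_cuts_eq heq] at this
  exact not_ordinary_mem_initial_marked y this

/-- Every intermediate polytope of a run with `N` iterations has at most `2 N` vertices. -/
theorem IsRun.encard_vertices_le {D : Problem 3 m n} {q : Fin 3 → ℝ} {N : ℕ} {σ : ℕ → State 3}
    (hQ : ∀ y ∈ D.Q, 0 ≤ y) (h0 : (0 : Fin 3 → ℝ) ∉ D.Q) (hq : q ∈ interior D.Qplus)
    (h : IsRun D q N σ) {i : ℕ} (hi : i ≤ N) :
    (vertices (σ i).planes).encard ≤ ((2 * N : ℕ) : ℕ∞) := by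
  have hqpos := pos_of_mem_interior_Qplus hQ hq
  have h1 := h.one_le_cuts hQ h0 hqpos
  have h2 := h.cuts_lt hqpos
  obtain ⟨hle, heq⟩ := h.cuts_mono hi le_rfl
  rcases hle.eq_or_lt with hc | hc
  -- No cut follows, so this is the final polytope and its vertices are bounded by the marked
  -- points.
  · rw [← heq hc]
    refine (Set.encard_le_encard h.2.2).trans
      ((h.invariant hqpos le_rfl).encard_marked_le.trans ?_)
    norm_cast
    omega
  -- At least one cut is still to come, so the number of cuts so far is at most `N - 2`, and there
  -- are at most `N + 2` planes.
  · have hI := h.invariant hqpos hi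
    have hfin : (σ i).planes.Finite := Set.finite_of_encard_le_coe hI.encard_planes_le
    have h3 := (regionNonneg_of_initial_subset hI.initial_subset).encard_vertices_add_four_le hfin
      hI.side_pos
    have h4 : (vertices (σ i).planes).encard + 4 ≤ ((2 * N : ℕ) : ℕ∞) + 4 := by
      refine h3.trans ((mul_le_mul_right hI.encard_planes_le 2).trans ?_)
      norm_cast
      omega
    exact (ENat.add_le_add_iff_right (by simp)).1 h4

end Benson

namespace Halfspaces

/-! ### Points with polar coordinates at multiples of `π / (2 n)` -/

/-- The cosine of `m` times the angle `π / (2 n)`. -/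
noncomputable def cosk (n : ℕ) (m : ℤ) : ℝ := Real.cos (m * (Real.pi / (2 * n)))

/-- The sine of `m` times the angle `π / (2 n)`. -/
noncomputable def sink (n : ℕ) (m : ℤ) : ℝ := Real.sin (m * (Real.pi / (2 * n)))

variable {n : ℕ}

theorem cosk_sub (k m : ℤ) : cosk n (k - m) = cosk n k * cosk n m + sink n k * sink n m := by
  simp only [cosk, sink, Int.cast_sub, sub_mul, Real.cos_sub]

theorem sink_sub (k m : ℤ) : sink n (k - m) = sink n k * cosk n m - cosk n k * sink n m := by
  simp only [cosk, sink, Int.cast_sub, sub_mul, Real.sin_sub]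

theorem cosk_sq_add_sink_sq (m : ℤ) : cosk n m ^ 2 + sink n m ^ 2 = 1 := Real.cos_sq_add_sin_sq _

theorem cosk_zero : cosk n 0 = 1 := by simp [cosk]

theorem cosk_neg (m : ℤ) : cosk n (-m) = cosk n m := by
  simp [cosk]

theorem angle_add (hn : 0 < n) (m q : ℤ) :
    ((m + 4 * n * q : ℤ) : ℝ) * (Real.pi / (2 * n)) =
      m * (Real.pi / (2 * n)) + q * (2 * Real.pi) := by
  have : (n : ℝ) ≠ 0 := Nat.cast_ne_zero.2 hn.ne'
  push_cast
  field_simp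
  ring

theorem cosk_add_period (hn : 0 < n) (m q : ℤ) : cosk n (m + 4 * n * q) = cosk n m := by
  rw [cosk, angle_add hn, Real.cos_add_int_mul_two_pi, cosk]

theorem sink_add_period (hn : 0 < n) (m q : ℤ) : sink n (m + 4 * n * q) = sink n m := by
  rw [sink, angle_add hn, Real.sin_add_int_mul_two_pi, sink]

theorem exists_eq_add_period (hn : 0 < n) (m : ℤ) :
    ∃ r q : ℤ, 0 ≤ r ∧ r < 4 * n ∧ m = r + 4 * n * q := by
  have h : (0 : ℤ) < 4 * n := by omega
  exact ⟨m % (4 * n), m / (4 * n), Int.emod_nonneg _ h.ne', Int.emod_lt_of_pos _ h,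
    (Int.emod_add_mul_ediv _ _).symm⟩

theorem pi_eq (hn : 0 < n) : Real.pi = ((2 * n : ℤ) : ℝ) * (Real.pi / (2 * n)) := by
  have : (n : ℝ) ≠ 0 := Nat.cast_ne_zero.2 hn.ne'
  push_cast
  field_simp

theorem step_pos (hn : 0 < n) : 0 < Real.pi / (2 * n) := by positivity

theorem cosk_lt_cosk_of_lt (hn : 0 < n) {s m : ℤ} (hs : 0 ≤ s) (hsm : s < m) (hm : m < 4 * n - s) :
    cosk n m < cosk n s := by
  have aux : ∀ k : ℤ, s < k → k ≤ 2 * n → cosk n k < cosk n s := by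
    intro k hsk hk
    have hp := step_pos hn
    refine Real.cos_lt_cos_of_nonneg_of_le_pi ?_ ?_ ?_
    · have : (0 : ℝ) ≤ s := by exact_mod_cast hs
      positivity
    · conv_rhs => rw [pi_eq hn]
      exact mul_le_mul_of_nonneg_right (by exact_mod_cast hk) hp.le
    · exact mul_lt_mul_of_pos_right (by exact_mod_cast hsk) hp
  rcases le_total m (2 * n) with h | h
  · exact aux m hsm h
  · have h1 : cosk n m = cosk n (4 * n - m) := by
      rw [← cosk_neg m, ← cosk_add_period hn (-m) 1]
      congr 1
      ring
    rw [h1]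
    exact aux _ (by omega) (by omega)

theorem sink_pos (hn : 0 < n) {m : ℤ} (h0 : 0 < m) (h1 : m < 2 * n) : 0 < sink n m := by
  have hp := step_pos hn
  refine Real.sin_pos_of_pos_of_lt_pi ?_ ?_
  · have : (0 : ℝ) < m := by exact_mod_cast h0
    positivity
  · conv_rhs => rw [pi_eq hn]
    exact mul_lt_mul_of_pos_right (by exact_mod_cast h1) hp

theorem cosk_pos (hn : 0 < n) {m : ℤ} (h0 : 0 ≤ m) (h1 : m < n) : 0 < cosk n m := by
  have h2 : cosk n n = 0 := by
    have h3 : ((n : ℤ) : ℝ) * (Real.pi / (2 * n)) = Real.pi / 2 := by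
      have : (n : ℝ) ≠ 0 := Nat.cast_ne_zero.2 hn.ne'
      push_cast
      field_simp
    rw [cosk, h3, Real.cos_pi_div_two]
  rw [← h2]
  exact cosk_lt_cosk_of_lt hn h0 h1 (by omega)

theorem cosk_le_one (m : ℤ) : cosk n m ≤ 1 := Real.cos_le_one _

/-- Among the side directions, those nearest to a polygon vertex are one unit away; this puts every
vertex of the polygon on the right side of all planes. -/
theorem cosk_odd_le (hn : 0 < n) {m : ℤ} (hm : Odd m) : cosk n m ≤ cosk n 1 := by
  obtain ⟨r, q, h0, h1, rfl⟩ := exists_eq_add_period hn m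
  obtain ⟨k, hk⟩ := hm
  rw [cosk_add_period hn]
  rw [mul_assoc] at hk
  generalize (n : ℤ) * q = w at hk
  rcases eq_or_ne r 1 with rfl | hr
  · exact le_rfl
  rcases eq_or_ne r (4 * n - 1) with rfl | hr'
  · rw [← cosk_neg 1, ← cosk_add_period hn (-1) 1]
    apply le_of_eq
    congr 1
    ring
  · exact (cosk_lt_cosk_of_lt hn (by norm_num) (by omega) (by omega)).le

theorem eq_of_cosk_odd_eq (hn : 0 < n) {m : ℤ} (hm : Odd m) (heq : cosk n m = cosk n 1) :
    ∃ q : ℤ, m = 1 + 4 * n * q ∨ m = -1 + 4 * n * q := by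
  obtain ⟨r, q, h0, h1, rfl⟩ := exists_eq_add_period hn m
  obtain ⟨k, hk⟩ := hm
  rw [cosk_add_period hn] at heq
  rw [mul_assoc] at hk
  rcases eq_or_ne r 1 with rfl | hr
  · exact ⟨q, Or.inl rfl⟩
  rcases eq_or_ne r (4 * n - 1) with rfl | hr'
  · exact ⟨q + 1, Or.inr (by ring)⟩
  · generalize (n : ℤ) * q = w at hk
    exact absurd heq (cosk_lt_cosk_of_lt hn (by norm_num) (by omega) (by omega)).ne

/-- Used for the planes that remain next to an omitted one. The period `4 n` is divisible by 4, so
reduction keeps the index congruent to 2 modulo 4 and never reaches 0. -/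
theorem cosk_two_mul_odd_le (hn : 0 < n) {m : ℤ} (hm : Odd m) : cosk n (2 * m) ≤ cosk n 2 := by
  obtain ⟨k, rfl⟩ := hm
  obtain ⟨r, q, h0, h1, hr⟩ := exists_eq_add_period hn (2 * (2 * k + 1))
  rw [hr, cosk_add_period hn]
  rw [mul_assoc] at hr
  generalize (n : ℤ) * q = w at hr
  rcases eq_or_ne r 2 with rfl | hr2
  · exact le_rfl
  rcases eq_or_ne r (4 * n - 2) with rfl | hr'
  · rw [← cosk_neg 2, ← cosk_add_period hn (-2) 1]
    apply le_of_eq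
    congr 1
    ring
  · exact (cosk_lt_cosk_of_lt hn (by norm_num) (by omega) (by omega)).le

theorem cosk_lt_one (hn : 0 < n) {m : ℤ} (h0 : m ≠ 0) (h1 : |m| < 4 * n) : cosk n m < 1 := by
  rw [← cosk_zero (n := n)]
  obtain ⟨h1, h2⟩ := abs_lt.1 h1
  rcases lt_or_gt_of_ne h0 with h | h
  · rw [← cosk_neg]
    exact cosk_lt_cosk_of_lt hn le_rfl (by omega) (by omega)
  · exact cosk_lt_cosk_of_lt hn le_rfl h (by omega)

/-- Every point of the plane is a non-negative combination of two adjacent directions. -/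
theorem exists_sector (hn : 0 < n) (x y : ℝ) : ∃ (m : ℤ) (s t : ℝ), 0 ≤ s ∧ 0 ≤ t ∧
    x = s * cosk n m + t * cosk n (m + 1) ∧ y = s * sink n m + t * sink n (m + 1) := by
  have hp := step_pos hn
  set τ := Real.pi / (2 * n) with hτ
  set φ := Complex.arg ⟨x, y⟩
  set r := ‖(⟨x, y⟩ : ℂ)‖
  have hx : x = r * Real.cos φ := (Complex.norm_mul_cos_arg ⟨x, y⟩).symm
  have hy : y = r * Real.sin φ := (Complex.norm_mul_sin_arg ⟨x, y⟩).symm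
  have hr : 0 ≤ r := norm_nonneg _
  have hτπ : τ ≤ Real.pi := div_le_self Real.pi_pos.le (by
    have : (1 : ℝ) ≤ n := by exact_mod_cast hn
    linarith)
  have hs1 : 0 < sink n 1 := sink_pos hn one_pos (by omega)
  have h1 : (⌊φ / τ⌋ : ℝ) * τ ≤ φ := (le_div_iff₀ hp).1 (Int.floor_le _)
  have h2 : φ < (⌊φ / τ⌋ + 1) * τ := (div_lt_iff₀ hp).1 (Int.lt_floor_add_one _)
  set m := ⌊φ / τ⌋
  have hden : sink n 1 = sink n (m + 1) * cosk n m - cosk n (m + 1) * sink n m := by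
    rw [← sink_sub]; congr 1; ring
  -- These are the coordinates of the point in the basis of the two adjacent directions, by the law
  -- of sines; `m` is the integer part of the polar angle in units of `τ`.
  refine ⟨m, r * Real.sin ((m + 1) * τ - φ) / sink n 1, r * Real.sin (φ - m * τ) / sink n 1,
    ?_, ?_, ?_, ?_⟩
  · exact div_nonneg (mul_nonneg hr (Real.sin_nonneg_of_nonneg_of_le_pi (by linarith)
      (by linarith))) hs1.le
  · exact div_nonneg (mul_nonneg hr (Real.sin_nonneg_of_nonneg_of_le_pi (by linarith)
      (by linarith))) hs1.le
  · rw [div_mul_eq_mul_div, div_mul_eq_mul_div, ← add_div, eq_div_iff hs1.ne', hden, hx,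
      Real.sin_sub, Real.sin_sub]
    simp only [cosk, sink, Int.cast_add, Int.cast_one, ← hτ]
    ring
  · rw [div_mul_eq_mul_div, div_mul_eq_mul_div, ← add_div, eq_div_iff hs1.ne', hden, hy,
      Real.sin_sub, Real.sin_sub]
    simp only [cosk, sink, Int.cast_add, Int.cast_one, ← hτ]
    ring

/-- The point with cylindrical coordinates `r`, `m π / (2 n)`, `z`. -/
noncomputable def cylPoint (n : ℕ) (r z : ℝ) (m : ℤ) : Fin 3 → ℝ :=
  ![r * cosk n m, r * sink n m, z]

theorem cylPoint_dotProduct (r z r' z' : ℝ) (m m' : ℤ) :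
    cylPoint n r z m ⬝ᵥ cylPoint n r' z' m' = r * r' * cosk n (m - m') + z * z' := by
  rw [cosk_sub]
  simp [cylPoint, dotProduct, Fin.sum_univ_three]
  ring

theorem cylPoint_add_period (hn : 0 < n) (r z : ℝ) (m q : ℤ) :
    cylPoint n r z (m + 4 * n * q) = cylPoint n r z m := by
  rw [cylPoint, cosk_add_period hn, sink_add_period hn, cylPoint]

theorem eq_of_cylPoint_eq (hn : 0 < n) {r z z' : ℝ} (hr : r ≠ 0) {m m' : ℤ}
    (hlt : |m - m'| < 4 * n) (h : cylPoint n r z m = cylPoint n r z' m') : m = m' := by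
  by_contra hne
  have h0 : r * cosk n m = r * cosk n m' := congrFun h 0
  have h1 : r * sink n m = r * sink n m' := congrFun h 1
  have h2 := cosk_lt_one hn (sub_ne_zero.2 hne) hlt
  rw [cosk_sub, mul_left_cancel₀ hr h0, mul_left_cancel₀ hr h1] at h2
  have := cosk_sq_add_sink_sq (n := n) m'
  linarith [sq (cosk n m'), sq (sink n m')]

/-- The first two coordinates of a point are determined by its scalar products with two different
directions. -/
theorem eq_of_two_directions {k m : ℤ} (hs : sink n (m - k) ≠ 0) {x y x' y' : ℝ}
    (h1 : cosk n k * x + sink n k * y = cosk n k * x' + sink n k * y')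
    (h2 : cosk n m * x + sink n m * y = cosk n m * x' + sink n m * y') : x = x' ∧ y = y' := by
  rw [sink_sub] at hs
  constructor
  · refine mul_left_cancel₀ hs ?_
    linear_combination sink n m * h1 - sink n k * h2
  · refine mul_left_cancel₀ hs ?_
    linear_combination cosk n k * h2 - cosk n m * h1

end Halfspaces

namespace Halfspaces

/-! ### Double pyramids -/

theorem convex_face {ι : Type*} {d : ℕ} {a : ι → Fin d → ℝ} {c : ι → ℝ} (i : ι) :
    Convex ℝ (face a c i) := by
  intro x hx y hy s t hs ht hst
  refine ⟨convex_polyhedron hx.1 hy.1 hs ht hst, ?_⟩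
  rw [dotProduct_add, dotProduct_smul, dotProduct_smul, hx.2, hy.2, ← add_smul, hst, one_smul]

theorem mem_extremePoints_of_tight_eq_zero {ι : Type*} {d : ℕ} {a : ι → Fin d → ℝ} {c : ι → ℝ}
    {x : Fin d → ℝ} (hx : x ∈ polyhedron a c) (J : Set ι) (hJ : ∀ i ∈ J, a i ⬝ᵥ x = c i)
    (h : ∀ e, (∀ i ∈ J, a i ⬝ᵥ e = 0) → e = 0) : x ∈ (polyhedron a c).extremePoints ℝ :=
  mem_extremePoints_of_forall_tight hx J hJ fun y hy => sub_eq_zero.1 <| h _ fun i hi => by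
    rw [dotProduct_sub, hy i hi, hJ i hi, sub_self]

variable {n : ℕ} {R a b : ℝ}

/-- A normal vector of the plane through the `k`-th side of the polygon that meets the axis at
height `h⁻¹`. -/
noncomputable def sideNormal (n : ℕ) (R h : ℝ) (k : ℤ) : Fin 3 → ℝ :=
  cylPoint n (R * cosk n 1)⁻¹ h (2 * k + 1)

/-- The vertices of the polygon. -/
noncomputable def rim (n : ℕ) (R : ℝ) (k : ℤ) : Fin 3 → ℝ := cylPoint n R 0 (2 * k)

/-- The common point of the planes of the `k`-th bottom facet and the top facets next to the
`k`-th one. -/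
noncomputable def outer (n : ℕ) (R a b : ℝ) (k : ℤ) : Fin 3 → ℝ :=
  cylPoint n (R * cosk n 1 * (a + b) / (a * cosk n 2 + b))
    (a * b * (1 - cosk n 2) / (a * cosk n 2 + b)) (2 * k + 1)

/-- The double pyramid from which all top facets have been left out except those with index
in `T`. -/
noncomputable def cutPyramid (n : ℕ) (R a b : ℝ) (T : Set ℤ) : Set (Fin 3 → ℝ) :=
  polyhedron (Sum.elim (fun k : T => sideNormal n R a⁻¹ k) (sideNormal n R (-b⁻¹))) fun _ => 1

theorem mem_cutPyramid {T : Set ℤ} {x : Fin 3 → ℝ} : x ∈ cutPyramid n R a b T ↔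
    (∀ k ∈ T, sideNormal n R a⁻¹ k ⬝ᵥ x ≤ 1) ∧ ∀ k, sideNormal n R (-b⁻¹) k ⬝ᵥ x ≤ 1 := by
  simp [cutPyramid, polyhedron]

theorem sideNormal_dotProduct (h : ℝ) (k : ℤ) (x : Fin 3 → ℝ) : sideNormal n R h k ⬝ᵥ x =
    (R * cosk n 1)⁻¹ * (cosk n (2 * k + 1) * x 0 + sink n (2 * k + 1) * x 1) + h * x 2 := by
  simp [sideNormal, cylPoint, dotProduct, Fin.sum_univ_three]
  ring

theorem sideNormal_dotProduct_cylPoint (h r z : ℝ) (k m : ℤ) :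
    sideNormal n R h k ⬝ᵥ cylPoint n r z m =
      (R * cosk n 1)⁻¹ * r * cosk n (2 * k + 1 - m) + h * z :=
  cylPoint_dotProduct _ _ _ _ _ _

theorem sideNormal_dotProduct_axis (h z : ℝ) (k : ℤ) :
    sideNormal n R h k ⬝ᵥ ![0, 0, z] = h * z := by
  rw [sideNormal_dotProduct]
  simp

theorem sideNormal_add_period (hn : 0 < n) (h : ℝ) (k q : ℤ) :
    sideNormal n R h (k + 2 * n * q) = sideNormal n R h k := by
  rw [sideNormal, show 2 * (k + 2 * n * q) + 1 = 2 * k + 1 + 4 * n * q by ring,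
    cylPoint_add_period hn, sideNormal]

theorem rim_add_period (hn : 0 < n) (k q : ℤ) : rim n R (k + 2 * n * q) = rim n R k := by
  rw [rim, show 2 * (k + 2 * n * q) = 2 * k + 4 * n * q by ring, cylPoint_add_period hn, rim]

theorem cosk_one_pos (hn : 3 ≤ n) : 0 < cosk n 1 := cosk_pos (by omega) (by norm_num) (by omega)

theorem cosk_two_pos (hn : 3 ≤ n) : 0 < cosk n 2 := cosk_pos (by omega) (by norm_num) (by omega)

theorem cosk_two_lt_one (hn : 3 ≤ n) : cosk n 2 < 1 :=
  cosk_lt_one (by omega) (by norm_num) (by rw [abs_of_pos (by norm_num)]; omega)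

theorem sideNormal_dotProduct_rim (hn : 3 ≤ n) (hR : 0 < R) (h : ℝ) (k j : ℤ) :
    sideNormal n R h k ⬝ᵥ rim n R j = cosk n (2 * (k - j) + 1) / cosk n 1 := by
  have h1 := cosk_one_pos hn
  rw [rim, sideNormal_dotProduct_cylPoint, mul_zero, add_zero,
    show 2 * k + 1 - 2 * j = 2 * (k - j) + 1 by ring]
  field_simp

theorem sideNormal_dotProduct_rim_le (hn : 3 ≤ n) (hR : 0 < R) (h : ℝ) (k j : ℤ) :
    sideNormal n R h k ⬝ᵥ rim n R j ≤ 1 := by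
  rw [sideNormal_dotProduct_rim hn hR, div_le_one (cosk_one_pos hn)]
  exact cosk_odd_le (by omega) (odd_two_mul_add_one _)

theorem sideNormal_dotProduct_rim_eq (hn : 3 ≤ n) (hR : 0 < R) (h : ℝ) {k j : ℤ}
    (hj : j = k ∨ j = k + 1) : sideNormal n R h k ⬝ᵥ rim n R j = 1 := by
  rw [sideNormal_dotProduct_rim hn hR]
  have h1 := (cosk_one_pos hn).ne'
  rcases hj with rfl | rfl
  · rw [sub_self, mul_zero, zero_add, div_self h1]
  · rw [show 2 * (k - (k + 1)) + 1 = -1 by ring, cosk_neg, div_self h1]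

theorem rim_eq_of_sideNormal_eq (hn : 3 ≤ n) (hR : 0 < R) (h : ℝ) {k j : ℤ}
    (heq : sideNormal n R h k ⬝ᵥ rim n R j = 1) :
    rim n R j = rim n R k ∨ rim n R j = rim n R (k + 1) := by
  rw [sideNormal_dotProduct_rim hn hR, div_eq_one_iff_eq (cosk_one_pos hn).ne'] at heq
  obtain ⟨q, hq | hq⟩ := eq_of_cosk_odd_eq (by omega) (odd_two_mul_add_one _) heq
  · left
    rw [← rim_add_period (by omega) j q]
    congr 1
    linarith
  · right
    rw [← rim_add_period (by omega) j q]
    congr 1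
    linarith

theorem sideNormal_dotProduct_outer (hn : 3 ≤ n) (hR : 0 < R) (ha : 0 < a) (hb : 0 < b) (h : ℝ)
    (j k : ℤ) : sideNormal n R h j ⬝ᵥ outer n R a b k =
      ((a + b) * cosk n (2 * (j - k)) + h * (a * b * (1 - cosk n 2))) / (a * cosk n 2 + b) := by
  have h1 := cosk_one_pos hn
  have h2 := cosk_two_pos hn
  have hD : 0 < a * cosk n 2 + b := by positivity
  rw [outer, sideNormal_dotProduct_cylPoint, show 2 * j + 1 - (2 * k + 1) = 2 * (j - k) by ring]
  field_simp

theorem outer_denominator_pos (hn : 3 ≤ n) (ha : 0 < a) (hb : 0 < b) : 0 < a * cosk n 2 + b := by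
  have h2 := cosk_two_pos hn
  positivity

theorem bottom_dotProduct_outer_le (hn : 3 ≤ n) (hR : 0 < R) (ha : 0 < a) (hb : 0 < b) (j k : ℤ) :
    sideNormal n R (-b⁻¹) j ⬝ᵥ outer n R a b k ≤ 1 := by
  rw [sideNormal_dotProduct_outer hn hR ha hb, div_le_one (outer_denominator_pos hn ha hb)]
  have h1 : -b⁻¹ * (a * b * (1 - cosk n 2)) = -(a * (1 - cosk n 2)) := by field_simp
  have h2 := mul_le_mul_of_nonneg_left (cosk_le_one (n := n) (2 * (j - k))) (add_pos ha hb).le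
  rw [h1]
  linarith

theorem bottom_dotProduct_outer_self (hn : 3 ≤ n) (hR : 0 < R) (ha : 0 < a) (hb : 0 < b) (k : ℤ) :
    sideNormal n R (-b⁻¹) k ⬝ᵥ outer n R a b k = 1 := by
  rw [sideNormal_dotProduct_outer hn hR ha hb, div_eq_one_iff_eq (outer_denominator_pos hn ha hb).ne',
    sub_self, mul_zero, cosk_zero]
  field_simp
  ring

theorem top_dotProduct_outer_le (hn : 3 ≤ n) (hR : 0 < R) (ha : 0 < a) (hb : 0 < b) {j k : ℤ}
    (hjk : Odd (j - k)) : sideNormal n R a⁻¹ j ⬝ᵥ outer n R a b k ≤ 1 := by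
  rw [sideNormal_dotProduct_outer hn hR ha hb, div_le_one (outer_denominator_pos hn ha hb)]
  have h1 : a⁻¹ * (a * b * (1 - cosk n 2)) = b * (1 - cosk n 2) := by field_simp
  have h2 := mul_le_mul_of_nonneg_left (cosk_two_mul_odd_le (n := n) (by omega) hjk)
    (add_pos ha hb).le
  rw [h1]
  linarith

theorem top_dotProduct_outer_eq (hn : 3 ≤ n) (hR : 0 < R) (ha : 0 < a) (hb : 0 < b) {j k : ℤ}
    (hjk : j = k - 1 ∨ j = k + 1) : sideNormal n R a⁻¹ j ⬝ᵥ outer n R a b k = 1 := by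
  have h1 : cosk n (2 * (j - k)) = cosk n 2 := by
    rcases hjk with rfl | rfl
    · rw [← cosk_neg]; congr 1; ring
    · congr 1; ring
  rw [sideNormal_dotProduct_outer hn hR ha hb, div_eq_one_iff_eq (outer_denominator_pos hn ha hb).ne',
    h1]
  field_simp
  ring

/-! ### Points of the double pyramids as convex combinations -/

/-- The remaining weight `1 - s - t` and the height `z` are distributed over the two apexes; the two
inequalities say exactly that both apex weights are non-negative. -/
theorem mem_of_axis_combination {K : Set (Fin 3 → ℝ)} (hK : Convex ℝ K) (ha : 0 < a) (hb : 0 < b)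
    (hA : ![0, 0, a] ∈ K) (hB : ![0, 0, -b] ∈ K) {u w : Fin 3 → ℝ} (hu : u ∈ K) (hw : w ∈ K)
    {s t z : ℝ} (hs : 0 ≤ s) (ht : 0 ≤ t) (htop : s + t + a⁻¹ * z ≤ 1)
    (hbot : s + t + -b⁻¹ * z ≤ 1) : s • u + t • w + ![0, 0, z] ∈ K := by
  have hab : 0 < a + b := add_pos ha hb
  have h1 : 0 ≤ (z + b * (1 - s - t)) / (a + b) := by
    refine div_nonneg ?_ hab.le
    have := mul_le_mul_of_nonneg_left hbot hb.le
    have h2 : b * (-b⁻¹ * z) = -z := by field_simp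
    linarith
  have h2 : 0 ≤ (a * (1 - s - t) - z) / (a + b) := by
    refine div_nonneg ?_ hab.le
    have := mul_le_mul_of_nonneg_left htop ha.le
    have h2 : a * (a⁻¹ * z) = z := by field_simp
    linarith
  have h3 := hK.sum_mem (t := Finset.univ)
    (w := ![s, t, (z + b * (1 - s - t)) / (a + b), (a * (1 - s - t) - z) / (a + b)])
    (z := ![u, w, ![0, 0, a], ![0, 0, -b]])
    (by intro i _; fin_cases i <;> assumption)
    (by
      simp only [Fin.sum_univ_four, Matrix.cons_val]
      field_simp
      ring)
    (by intro i _; fin_cases i <;> assumption)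
  convert h3 using 1
  simp only [Fin.sum_univ_four, Matrix.cons_val]
  rw [add_assoc (_ + _)]
  congr 1
  ext i
  fin_cases i <;> simp
  field_simp
  ring

/-- Every point of the plane lies in a half-sector between a vertex of the polygon and the middle of
an adjacent side. -/
theorem exists_half_sector (hn : 0 < n) (x y : ℝ) : ∃ (k k' : ℤ) (s t : ℝ),
    (k' = k ∨ k' = k + 1) ∧ 0 ≤ s ∧ 0 ≤ t ∧
    x = s * cosk n (2 * k') + t * cosk n (2 * k + 1) ∧
    y = s * sink n (2 * k') + t * sink n (2 * k + 1) := by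
  obtain ⟨m, s, t, hs, ht, hx, hy⟩ := exists_sector hn x y
  rcases Int.even_or_odd' m with ⟨k, rfl | rfl⟩
  · exact ⟨k, k, s, t, Or.inl rfl, hs, ht, hx, hy⟩
  · refine ⟨k, k + 1, t, s, Or.inr rfl, ht, hs, ?_, ?_⟩
    · rw [hx, show 2 * k + 1 + 1 = 2 * (k + 1) by ring, add_comm]
    · rw [hy, show 2 * k + 1 + 1 = 2 * (k + 1) by ring, add_comm]

/-- Over each half-sector one top plane `j` and one bottom plane `k` suffice. Both pass through the
polygon vertex `k'` and through a further point of `K` in the direction of the side's midpoint, so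
at `x` they become the two inequalities of `mem_of_axis_combination`. -/
theorem cutPyramid_subset (hn : 3 ≤ n) (hR : 0 < R) (ha : 0 < a) (hb : 0 < b) {T : Set ℤ}
    {K : Set (Fin 3 → ℝ)} (hK : Convex ℝ K) (hA : ![0, 0, a] ∈ K) (hB : ![0, 0, -b] ∈ K)
    (hrim : ∀ k, rim n R k ∈ K)
    (hsector : ∀ k k' : ℤ, (k' = k ∨ k' = k + 1) → ∃ r z : ℝ, 0 < r ∧ cylPoint n r z (2 * k + 1) ∈ K ∧
      sideNormal n R (-b⁻¹) k ⬝ᵥ cylPoint n r z (2 * k + 1) = 1 ∧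
      ∃ j ∈ T, (k' = j ∨ k' = j + 1) ∧ sideNormal n R a⁻¹ j ⬝ᵥ cylPoint n r z (2 * k + 1) = 1) :
    cutPyramid n R a b T ⊆ K := by
  intro x hx
  obtain ⟨htop, hbot⟩ := mem_cutPyramid.1 hx
  obtain ⟨k, k', s, t, hk', hs, ht, hx0, hx1⟩ := exists_half_sector (by omega : 0 < n) (x 0) (x 1)
  obtain ⟨r, z, hr, hw, hwbot, j, hj, hk'j, hwtop⟩ := hsector k k' hk'
  have hxeq : x = (s / R) • rim n R k' + (t / r) • cylPoint n r z (2 * k + 1) +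
      ![0, 0, x 2 - t / r * z] := by
    ext i
    fin_cases i
    · simp only [rim, cylPoint]
      simp
      rw [hx0]
      field_simp
    · simp only [rim, cylPoint]
      simp
      rw [hx1]
      field_simp
    · simp [rim, cylPoint]
  have h1 := htop j hj
  have h2 := hbot k
  rw [hxeq, dotProduct_add, dotProduct_add, dotProduct_smul, dotProduct_smul,
    sideNormal_dotProduct_axis, smul_eq_mul, smul_eq_mul] at h1 h2
  rw [sideNormal_dotProduct_rim_eq hn hR _ hk'j, hwtop, mul_one, mul_one] at h1
  rw [sideNormal_dotProduct_rim_eq hn hR _ hk', hwbot, mul_one, mul_one] at h2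
  rw [hxeq]
  exact mem_of_axis_combination hK ha hb hA hB (hrim k') hw (div_nonneg hs hR.le)
    (div_nonneg ht hr.le) h1 h2

theorem midpoint_rim (k : ℤ) : cylPoint n (R * cosk n 1) 0 (2 * k + 1) =
    (1 / 2 : ℝ) • rim n R k + (1 / 2 : ℝ) • rim n R (k + 1) := by
  have h1 := cosk_sub (n := n) (2 * k + 1) 1
  have h2 := cosk_sub (n := n) (2 * k + 1) (-1)
  have h3 := sink_sub (n := n) (2 * k + 1) 1
  have h4 := sink_sub (n := n) (2 * k + 1) (-1)
  have h5 : sink n (-1) = - sink n 1 := by simp [sink]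
  rw [show 2 * k + 1 - 1 = 2 * k by ring] at h1 h3
  rw [show 2 * k + 1 - -1 = 2 * (k + 1) by ring, cosk_neg, h5] at h2 h4
  ext i
  fin_cases i
  · simp [rim, cylPoint]
    rw [h1, h2]
    ring
  · simp [rim, cylPoint]
    rw [h3, h4]
    ring
  · simp [rim, cylPoint]

/-- The half-sectors at a side whose top facet is kept. -/
theorem exists_sector_point_of_mem (hn : 3 ≤ n) (hR : 0 < R) {T : Set ℤ}
    {K : Set (Fin 3 → ℝ)} (hK : Convex ℝ K) (hrim : ∀ k, rim n R k ∈ K) {k k' : ℤ} (hk : k ∈ T)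
    (hk' : k' = k ∨ k' = k + 1) : ∃ r z : ℝ, 0 < r ∧ cylPoint n r z (2 * k + 1) ∈ K ∧
      sideNormal n R (-b⁻¹) k ⬝ᵥ cylPoint n r z (2 * k + 1) = 1 ∧
      ∃ j ∈ T, (k' = j ∨ k' = j + 1) ∧ sideNormal n R a⁻¹ j ⬝ᵥ cylPoint n r z (2 * k + 1) = 1 := by
  have hpos : 0 < R * cosk n 1 := mul_pos hR (cosk_one_pos hn)
  have hmid : ∀ h : ℝ, sideNormal n R h k ⬝ᵥ cylPoint n (R * cosk n 1) 0 (2 * k + 1) = 1 := by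
    intro h
    rw [sideNormal_dotProduct_cylPoint, sub_self, cosk_zero, inv_mul_cancel₀ hpos.ne']
    ring
  refine ⟨R * cosk n 1, 0, hpos, ?_, hmid _, k, hk, hk', hmid _⟩
  rw [midpoint_rim]
  exact hK (hrim k) (hrim (k + 1)) (by norm_num) (by norm_num) (by norm_num)

theorem rim_mem_cutPyramid (hn : 3 ≤ n) (hR : 0 < R) {T : Set ℤ} (k : ℤ) :
    rim n R k ∈ cutPyramid n R a b T :=
  mem_cutPyramid.2 ⟨fun _ _ => sideNormal_dotProduct_rim_le hn hR _ _ _,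
    fun _ => sideNormal_dotProduct_rim_le hn hR _ _ _⟩

theorem top_mem_cutPyramid (ha : 0 < a) (hb : 0 < b) {T : Set ℤ} :
    ![0, 0, a] ∈ cutPyramid n R a b T := by
  simp only [mem_cutPyramid, sideNormal_dotProduct_axis]
  refine ⟨fun _ _ => (inv_mul_cancel₀ ha.ne').le, fun _ => ?_⟩
  have : 0 < b⁻¹ * a := by positivity
  linarith

theorem bottom_mem_cutPyramid (ha : 0 < a) (hb : 0 < b) {T : Set ℤ} :
    ![0, 0, -b] ∈ cutPyramid n R a b T := by
  simp only [mem_cutPyramid, sideNormal_dotProduct_axis, neg_mul_neg]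
  refine ⟨fun _ _ => ?_, fun _ => (inv_mul_cancel₀ hb.ne').le⟩
  have : 0 < a⁻¹ * b := by positivity
  linarith

theorem outer_mem_cutPyramid (hn : 3 ≤ n) (hR : 0 < R) (ha : 0 < a) (hb : 0 < b) {k : ℤ}
    (hk : Even k) : outer n R a b k ∈ cutPyramid n R a b {j | Odd j} :=
  mem_cutPyramid.2 ⟨fun _ hj => top_dotProduct_outer_le hn hR ha hb (Odd.sub_even hj hk),
    fun _ => bottom_dotProduct_outer_le hn hR ha hb _ _⟩

theorem gonVertex_eq_rim (hn : 0 < n) (k : ℕ) : gonVertex n R k = rim n R k := by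
  have h0 : (n : ℝ) ≠ 0 := Nat.cast_ne_zero.2 hn.ne'
  have h1 : Real.pi * k / n = ((2 * (k : ℤ) : ℤ) : ℝ) * (Real.pi / (2 * n)) := by
    push_cast
    field_simp
  rw [gonVertex, h1]
  rfl

theorem range_gonVertex (hn : 0 < n) : Set.range (gonVertex n R) = Set.range (rim n R) := by
  refine Set.Subset.antisymm ?_ ?_
  · rintro _ ⟨k, rfl⟩
    exact ⟨k, (gonVertex_eq_rim hn k).symm⟩
  · rintro _ ⟨k, rfl⟩
    have hpos : (0 : ℤ) < 2 * n := by omega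
    refine ⟨(k % (2 * n)).toNat, ?_⟩
    rw [gonVertex_eq_rim hn, Int.toNat_of_nonneg (Int.emod_nonneg _ hpos.ne'), ← rim_add_period hn _ (k / (2 * n)),
      Int.emod_add_mul_ediv]

theorem bipyramid_eq_cutPyramid (hn : 3 ≤ n) (hR : 0 < R) (ha : 0 < a) (hb : 0 < b) :
    bipyramid n R a b = cutPyramid n R a b Set.univ := by
  have hn0 : 0 < n := by omega
  rw [bipyramid, range_gonVertex hn0]
  refine Set.Subset.antisymm (convexHull_min ?_ convex_polyhedron) ?_
  · rintro x (⟨k, rfl⟩ | rfl | rfl)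
    · exact rim_mem_cutPyramid hn hR k
    · exact top_mem_cutPyramid ha hb
    · exact bottom_mem_cutPyramid ha hb
  · have hK := convex_convexHull ℝ (Set.range (rim n R) ∪ {![0, 0, a], ![0, 0, -b]})
    have hrim : ∀ k, rim n R k ∈ convexHull ℝ (Set.range (rim n R) ∪ {![0, 0, a], ![0, 0, -b]}) :=
      fun k => subset_convexHull ℝ _ (Or.inl ⟨k, rfl⟩)
    exact cutPyramid_subset hn hR ha hb hK (subset_convexHull ℝ _ (Or.inr (Or.inl rfl)))
      (subset_convexHull ℝ _ (Or.inr (Or.inr rfl))) hrim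
      fun k k' hk' => exists_sector_point_of_mem hn hR hK hrim (Set.mem_univ k) hk'

/-- The vertices of the double pyramid without the top facets of even index. -/
noncomputable def reducedVertices (n : ℕ) (R a b : ℝ) : Set (Fin 3 → ℝ) :=
  Set.range (rim n R) ∪ {![0, 0, a], ![0, 0, -b]} ∪ outer n R a b '' {k | Even k}

/-- Over a side of odd index the midpoint serves as the further sector point; over a side of even
index, whose top facet is missing, `outer` takes its place. -/
theorem cutPyramid_odd_eq (hn : 3 ≤ n) (hR : 0 < R) (ha : 0 < a) (hb : 0 < b) :
    cutPyramid n R a b {k | Odd k} = convexHull ℝ (reducedVertices n R a b) := by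
  refine Set.Subset.antisymm ?_ (convexHull_min ?_ convex_polyhedron)
  · have hK := convex_convexHull ℝ (reducedVertices n R a b)
    have hsub := subset_convexHull ℝ (reducedVertices n R a b)
    have hrim : ∀ k, rim n R k ∈ convexHull ℝ (reducedVertices n R a b) :=
      fun k => hsub (Or.inl (Or.inl ⟨k, rfl⟩))
    refine cutPyramid_subset hn hR ha hb hK (hsub (Or.inl (Or.inr (Or.inl rfl))))
      (hsub (Or.inl (Or.inr (Or.inr rfl)))) hrim fun k k' hk' => ?_
    rcases Int.even_or_odd k with hk | hk
    · refine ⟨_, _, ?_, hsub (Or.inr ⟨k, hk, rfl⟩), bottom_dotProduct_outer_self hn hR ha hb k, ?_⟩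
      · have h1 := cosk_one_pos hn
        have h2 := outer_denominator_pos hn ha hb
        positivity
      -- The remaining top plane through the polygon vertex `k'` is the one over the neighbouring
      -- side that shares this vertex with side `k`.
      · rcases hk' with rfl | rfl
        · exact ⟨k' - 1, hk.sub_odd odd_one, Or.inr (by ring),
            top_dotProduct_outer_eq hn hR ha hb (Or.inl rfl)⟩
        · exact ⟨k + 1, hk.add_odd odd_one, Or.inl rfl,
            top_dotProduct_outer_eq hn hR ha hb (Or.inr rfl)⟩
    · exact exists_sector_point_of_mem hn hR hK hrim hk hk'
  · rintro x ((⟨k, rfl⟩ | rfl | rfl) | ⟨k, hk, rfl⟩)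
    · exact rim_mem_cutPyramid hn hR k
    · exact top_mem_cutPyramid ha hb
    · exact bottom_mem_cutPyramid ha hb
    · exact outer_mem_cutPyramid hn hR ha hb hk

end Halfspaces

namespace Halfspaces

variable {n : ℕ} {R a b : ℝ}

/-! ### Vertices of the double pyramids -/

/-- The scalar product of the direction with index `m` and the horizontal part of `e`. -/
noncomputable def dirDot (n : ℕ) (e : Fin 3 → ℝ) (m : ℤ) : ℝ :=
  cosk n m * e 0 + sink n m * e 1

/-- The addition formula for cosines; it compares planes placed symmetrically about a direction and
forces the vertical component of `e` to vanish. -/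
theorem dirDot_add_dirDot (e : Fin 3 → ℝ) (m k : ℤ) :
    dirDot n e (m - k) + dirDot n e (m + k) = 2 * cosk n k * dirDot n e m := by
  have h1 := cosk_sub (n := n) m k
  have h2 := cosk_sub (n := n) m (-k)
  have h3 := sink_sub (n := n) m k
  have h4 := sink_sub (n := n) m (-k)
  have h5 : sink n (-k) = - sink n k := by simp [sink]
  rw [sub_neg_eq_add, cosk_neg, h5] at h2 h4
  simp only [dirDot, h1, h2, h3, h4]
  ring

theorem eq_zero_of_dirDot (hn : 0 < n) {e : Fin 3 → ℝ} {k m : ℤ} (hk : k < m)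
    (hm : m < k + 2 * n) (h1 : dirDot n e k = 0) (h2 : dirDot n e m = 0) (h3 : e 2 = 0) :
    e = 0 := by
  obtain ⟨h4, h5⟩ := eq_of_two_directions (n := n) (k := k) (m := m) (x := e 0) (y := e 1) (x' := 0) (y' := 0)
    (sink_pos hn (by omega) (by omega)).ne' (by simpa [dirDot] using h1) (by simpa [dirDot] using h2)
  ext i
  fin_cases i
  · exact h4
  · exact h5
  · exact h3

theorem dirDot_of_sideNormal (hn : 3 ≤ n) (hR : 0 < R) {h : ℝ} {k : ℤ} {e : Fin 3 → ℝ}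
    (he : sideNormal n R h k ⬝ᵥ e = 0) :
    dirDot n e (2 * k + 1) = -(R * cosk n 1 * h * e 2) := by
  have hpos : 0 < R * cosk n 1 := mul_pos hR (cosk_one_pos hn)
  rw [sideNormal_dotProduct] at he
  rw [dirDot]
  have h1 := congrArg (fun x => R * cosk n 1 * x) he
  simp only [mul_add, mul_inv_cancel_left₀ hpos.ne', mul_zero] at h1
  linarith

/-- The three horizontal products are equal, so the symmetric relation gives a factor `1 - cosk n 4
> 0` and `e 2 = 0`. The spacing 2 lets the same argument serve when only odd indices remain. -/
theorem eq_zero_of_apex (hn : 3 ≤ n) (hR : 0 < R) {h : ℝ} (hh : h ≠ 0) {k : ℤ} {e : Fin 3 → ℝ}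
    (h1 : sideNormal n R h k ⬝ᵥ e = 0) (h2 : sideNormal n R h (k + 2) ⬝ᵥ e = 0)
    (h3 : sideNormal n R h (k + 4) ⬝ᵥ e = 0) : e = 0 := by
  have h1 := dirDot_of_sideNormal hn hR h1
  have h2 := dirDot_of_sideNormal hn hR h2
  have h3 := dirDot_of_sideNormal hn hR h3
  have h4 := dirDot_add_dirDot (n := n) e (2 * (k + 2) + 1) 4
  rw [show 2 * (k + 2) + 1 - 4 = 2 * k + 1 by ring,
    show 2 * (k + 2) + 1 + 4 = 2 * (k + 4) + 1 by ring, h1, h2, h3] at h4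
  have h5 : cosk n 4 < 1 :=
    cosk_lt_one (by omega) (by norm_num) (by rw [abs_of_pos (by norm_num)]; omega)
  have h6 : R * cosk n 1 * h * e 2 = 0 := by
    have : (1 - cosk n 4) * (R * cosk n 1 * h * e 2) = 0 := by linarith
    exact (mul_eq_zero.1 this).resolve_left (by linarith)
  have hne : R * cosk n 1 * h ≠ 0 := mul_ne_zero (mul_pos hR (cosk_one_pos hn)).ne' hh
  rw [h6, neg_zero] at h1 h2
  exact eq_zero_of_dirDot (by omega) (by omega) (by omega) h1 h2
    ((mul_eq_zero.1 h6).resolve_left hne)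

theorem top_mem_extremePoints (hn : 3 ≤ n) (hR : 0 < R) (ha : 0 < a) (hb : 0 < b) {T : Set ℤ}
    {k : ℤ} (h1 : k ∈ T) (h2 : k + 2 ∈ T) (h3 : k + 4 ∈ T) :
    ![0, 0, a] ∈ (cutPyramid n R a b T).extremePoints ℝ := by
  refine mem_extremePoints_of_tight_eq_zero (top_mem_cutPyramid ha hb) (Set.range Sum.inl) ?_
    fun e he => eq_zero_of_apex hn hR (inv_ne_zero ha.ne') (he _ ⟨⟨k, h1⟩, rfl⟩)
      (he _ ⟨⟨k + 2, h2⟩, rfl⟩) (he _ ⟨⟨k + 4, h3⟩, rfl⟩)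
  rintro _ ⟨j, rfl⟩
  exact (sideNormal_dotProduct_axis _ _ _).trans (inv_mul_cancel₀ ha.ne')

theorem bottom_mem_extremePoints (hn : 3 ≤ n) (hR : 0 < R) (ha : 0 < a) (hb : 0 < b) {T : Set ℤ} :
    ![0, 0, -b] ∈ (cutPyramid n R a b T).extremePoints ℝ := by
  refine mem_extremePoints_of_tight_eq_zero (bottom_mem_cutPyramid ha hb) (Set.range Sum.inr) ?_
    fun e he => eq_zero_of_apex hn hR (neg_ne_zero.2 (inv_ne_zero hb.ne')) (he _ ⟨0, rfl⟩)
      (he _ ⟨0 + 2, rfl⟩) (he _ ⟨0 + 4, rfl⟩)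
  rintro _ ⟨j, rfl⟩
  refine (sideNormal_dotProduct_axis _ _ _).trans ?_
  rw [neg_mul_neg, inv_mul_cancel₀ hb.ne']

theorem rim_mem_extremePoints (hn : 3 ≤ n) (hR : 0 < R) (ha : 0 < a) (hb : 0 < b) {T : Set ℤ}
    {k : ℤ} (hT : ∀ k, k ∈ T ∨ k + 1 ∈ T) :
    rim n R k ∈ (cutPyramid n R a b T).extremePoints ℝ := by
  have hpos : 0 < R * cosk n 1 := mul_pos hR (cosk_one_pos hn)
  obtain ⟨i, hi, hik⟩ : ∃ i ∈ T, i = k - 1 ∨ i = k := by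
    rcases hT (k - 1) with h | h
    · exact ⟨_, h, Or.inl rfl⟩
    · exact ⟨_, h, Or.inr (by ring)⟩
  have hik' : k = i ∨ k = i + 1 := by omega
  refine mem_extremePoints_of_tight_eq_zero (rim_mem_cutPyramid hn hR k)
    {Sum.inl ⟨i, hi⟩, Sum.inr (k - 1), Sum.inr k} ?_ fun e he => ?_
  · rintro _ (rfl | rfl | rfl)
    · exact sideNormal_dotProduct_rim_eq hn hR _ hik'
    · exact sideNormal_dotProduct_rim_eq hn hR _ (by omega)
    · exact sideNormal_dotProduct_rim_eq hn hR _ (by omega)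
  · have h1 := dirDot_of_sideNormal hn hR (he (Sum.inl ⟨i, hi⟩) (by simp))
    have h2 := dirDot_of_sideNormal hn hR (he (Sum.inr (k - 1)) (by simp))
    have h3 := dirDot_of_sideNormal hn hR (he (Sum.inr k) (by simp))
    -- The top plane shares its horizontal direction with one of the two bottom planes, while their
    -- slopes have opposite signs.
    have h4 : -(R * cosk n 1 * a⁻¹ * e 2) = -(R * cosk n 1 * -b⁻¹ * e 2) := by
      rcases hik with rfl | rfl
      · exact h1.symm.trans h2
      · exact h1.symm.trans h3
    have h5 : R * cosk n 1 * (a⁻¹ + b⁻¹) * e 2 = 0 := by linarith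
    have h6 : e 2 = 0 := (mul_eq_zero.1 h5).resolve_left (by positivity)
    rw [h6, mul_zero, neg_zero] at h2 h3
    exact eq_zero_of_dirDot (by omega) (by omega) (by omega) h2 h3 h6

theorem outer_mem_extremePoints (hn : 3 ≤ n) (hR : 0 < R) (ha : 0 < a) (hb : 0 < b) {k : ℤ}
    (hk : Even k) : outer n R a b k ∈ (cutPyramid n R a b {j | Odd j}).extremePoints ℝ := by
  have hpos : 0 < R * cosk n 1 := mul_pos hR (cosk_one_pos hn)
  have hc := cosk_two_pos hn
  have hk1 : k - 1 ∈ {j : ℤ | Odd j} := hk.sub_odd odd_one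
  have hk2 : k + 1 ∈ {j : ℤ | Odd j} := hk.add_odd odd_one
  refine mem_extremePoints_of_tight_eq_zero (outer_mem_cutPyramid hn hR ha hb hk)
    {Sum.inl ⟨k - 1, hk1⟩, Sum.inl ⟨k + 1, hk2⟩, Sum.inr k} ?_ fun e he => ?_
  · rintro _ (rfl | rfl | rfl)
    · exact top_dotProduct_outer_eq hn hR ha hb (Or.inl rfl)
    · exact top_dotProduct_outer_eq hn hR ha hb (Or.inr rfl)
    · exact bottom_dotProduct_outer_self hn hR ha hb k
  · have h1 := dirDot_of_sideNormal hn hR (he (Sum.inl ⟨k - 1, hk1⟩) (by simp))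
    have h2 := dirDot_of_sideNormal hn hR (he (Sum.inl ⟨k + 1, hk2⟩) (by simp))
    have h3 := dirDot_of_sideNormal hn hR (he (Sum.inr k) (by simp))
    have h4 := dirDot_add_dirDot (n := n) e (2 * k + 1) 2
    simp only at h1 h2
    rw [show 2 * k + 1 - 2 = 2 * (k - 1) + 1 by ring,
      show 2 * k + 1 + 2 = 2 * (k + 1) + 1 by ring, h1, h2, h3] at h4
    have h5 : R * cosk n 1 * (a⁻¹ + cosk n 2 * b⁻¹) * e 2 = 0 := by linarith
    have h6 : e 2 = 0 := (mul_eq_zero.1 h5).resolve_left (by positivity)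
    rw [h6, mul_zero, neg_zero] at h1 h2
    exact eq_zero_of_dirDot (by omega) (by omega) (by omega) h1 h2 h6

/-- The convex hull description bounds the set of vertices from above, the description by
inequalities from below. -/
theorem extremePoints_bipyramid (hn : 3 ≤ n) (hR : 0 < R) (ha : 0 < a) (hb : 0 < b) :
    (bipyramid n R a b).extremePoints ℝ = Set.range (rim n R) ∪ {![0, 0, a], ![0, 0, -b]} := by
  refine Set.Subset.antisymm ?_ ?_
  · rw [bipyramid, range_gonVertex (by omega)]
    exact extremePoints_convexHull_subset
  · rw [bipyramid_eq_cutPyramid hn hR ha hb]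
    rintro x (⟨k, rfl⟩ | rfl | rfl)
    · exact rim_mem_extremePoints hn hR ha hb fun k => Or.inl (Set.mem_univ k)
    · exact top_mem_extremePoints (k := 0) hn hR ha hb (Set.mem_univ _) (Set.mem_univ _) (Set.mem_univ _)
    · exact bottom_mem_extremePoints hn hR ha hb

theorem extremePoints_cutPyramid_odd (hn : 3 ≤ n) (hR : 0 < R) (ha : 0 < a) (hb : 0 < b) :
    (cutPyramid n R a b {k | Odd k}).extremePoints ℝ = reducedVertices n R a b := by
  refine Set.Subset.antisymm ?_ ?_
  · rw [cutPyramid_odd_eq hn hR ha hb]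
    exact extremePoints_convexHull_subset
  · rintro x ((⟨k, rfl⟩ | rfl | rfl) | ⟨k, hk, rfl⟩)
    · refine rim_mem_extremePoints hn hR ha hb fun k => ?_
      rcases Int.even_or_odd k with h | h
      · exact Or.inr h.add_one
      · exact Or.inl h
    · exact top_mem_extremePoints (k := 1) hn hR ha hb (by decide : Odd (1 : ℤ))
        (by decide : Odd (1 + 2 : ℤ)) (by decide : Odd (1 + 4 : ℤ))
    · exact bottom_mem_extremePoints hn hR ha hb
    · exact outer_mem_extremePoints hn hR ha hb hk

theorem encard_Ico_zero (m : ℕ) : (Set.Ico (0 : ℤ) m).encard = m := by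
  rw [← Finset.coe_Ico, Set.encard_coe_eq_coe_finsetCard, Int.card_Ico]
  simp

theorem encard_range_rim (hn : 0 < n) (hR : 0 < R) : (Set.range (rim n R)).encard = 2 * n := by
  have h : Set.range (rim n R) = rim n R '' Set.Ico (0 : ℤ) (2 * n : ℕ) := by
    refine Set.Subset.antisymm ?_ (Set.image_subset_range _ _)
    rintro _ ⟨k, rfl⟩
    have hpos : (0 : ℤ) < 2 * n := by omega
    refine ⟨k % (2 * n), ⟨Int.emod_nonneg _ hpos.ne', ?_⟩, ?_⟩
    · exact_mod_cast Int.emod_lt_of_pos k hpos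
    · rw [← rim_add_period hn _ (k / (2 * n)), Int.emod_add_mul_ediv]
  have hinj : Set.InjOn (rim n R) (Set.Ico (0 : ℤ) (2 * n : ℕ)) := by
    intro k hk j hj hkj
    have := eq_of_cylPoint_eq hn hR.ne' (by
      obtain ⟨h1, h2⟩ := hk
      obtain ⟨h3, h4⟩ := hj
      push_cast at h2 h4
      rw [abs_lt]
      constructor <;> linarith) hkj
    linarith
  rw [h, hinj.encard_image, encard_Ico_zero]
  norm_cast

theorem encard_outer (hn : 3 ≤ n) (hR : 0 < R) (ha : 0 < a) (hb : 0 < b) :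
    (outer n R a b '' {k | Even k}).encard = n := by
  have hn0 : 0 < n := by omega
  have h : outer n R a b '' {k | Even k} =
      (fun j => outer n R a b (2 * j)) '' Set.Ico (0 : ℤ) n := by
    refine Set.Subset.antisymm ?_ ?_
    · rintro _ ⟨k, hk, rfl⟩
      obtain ⟨j, rfl⟩ := even_iff_two_dvd.1 hk
      have hpos : (0 : ℤ) < n := by omega
      refine ⟨j % n, ⟨Int.emod_nonneg _ hpos.ne', Int.emod_lt_of_pos j hpos⟩, ?_⟩
      have h1 : 2 * (2 * j) + 1 = 2 * (2 * (j % n)) + 1 + 4 * n * (j / n) := by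
        linear_combination -4 * Int.emod_add_mul_ediv j n
      simp only [outer]
      rw [h1, cylPoint_add_period hn0]
    · rintro _ ⟨j, -, rfl⟩
      exact ⟨2 * j, even_two_mul j, rfl⟩
  have hinj : Set.InjOn (fun j => outer n R a b (2 * j)) (Set.Ico (0 : ℤ) n) := by
    intro k hk j hj hkj
    have h1 := cosk_one_pos hn
    have h2 := outer_denominator_pos hn ha hb
    have hr : R * cosk n 1 * (a + b) / (a * cosk n 2 + b) ≠ 0 := by positivity
    have := eq_of_cylPoint_eq hn0 hr (by
      obtain ⟨h1, h2⟩ := hk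
      obtain ⟨h3, h4⟩ := hj
      rw [abs_lt]
      constructor <;> linarith) hkj
    linarith
  rw [h, hinj.encard_image, encard_Ico_zero]

theorem encard_base (hn : 0 < n) (hR : 0 < R) (ha : 0 < a) (hb : 0 < b) :
    (Set.range (rim n R) ∪ {![0, 0, a], ![0, 0, -b]}).encard = 2 * n + 2 := by
  rw [Set.encard_union_eq, encard_range_rim hn hR, Set.encard_pair]
  · intro h
    have : a = -b := congrFun h 2
    linarith
  · rw [Set.disjoint_left]
    rintro _ ⟨k, rfl⟩ (h | h)
    · have : 0 = a := congrFun h 2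
      linarith
    · have : 0 = -b := congrFun h 2
      linarith

theorem encard_reducedVertices (hn : 3 ≤ n) (hR : 0 < R) (ha : 0 < a) (hb : 0 < b) :
    (reducedVertices n R a b).encard = 3 * n + 2 := by
  rw [reducedVertices, Set.encard_union_eq, encard_base (by omega) hR ha hb,
    encard_outer hn hR ha hb]
  · norm_cast
    ring
  · have h1 := cosk_two_lt_one hn
    have h2 := outer_denominator_pos hn ha hb
    have h3 : 0 < a * b * (1 - cosk n 2) / (a * cosk n 2 + b) := by
      have : 0 < 1 - cosk n 2 := by linarith
      positivity
    -- The new vertices lie strictly between the base plane and the top apex in height, so they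
    -- coincide with none of the old ones.
    have h4 : a * b * (1 - cosk n 2) / (a * cosk n 2 + b) < a := by
      rw [div_lt_iff₀ h2]
      have h5 := mul_pos (mul_pos ha (add_pos ha hb)) (cosk_two_pos hn)
      linarith
    rw [Set.disjoint_right]
    rintro _ ⟨k, -, rfl⟩ (⟨j, h⟩ | h | h)
    · exact h3.ne (congrFun h 2)
    · exact h4.ne (congrFun h 2)
    · have : a * b * (1 - cosk n 2) / (a * cosk n 2 + b) = -b := congrFun h 2
      linarith

/-! ### Facets of the double pyramid -/

/-- The normal vectors of the facets of the double pyramid. -/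
noncomputable def facetNormal (n : ℕ) (R a b : ℝ) : Fin (2 * n) ⊕ Fin (2 * n) → Fin 3 → ℝ :=
  Sum.elim (fun k => sideNormal n R a⁻¹ (k : ℕ)) fun k => sideNormal n R (-b⁻¹) (k : ℕ)

/-- Side indices matter modulo `2 n`. As `2 n` is even, parity survives the reduction, so "every
other facet" makes sense around the polygon. -/
theorem exists_fin_sideNormal_eq (hn : 0 < n) (k : ℤ) : ∃ j : Fin (2 * n),
    (Odd k ↔ Odd ((j : ℕ) : ℤ)) ∧ ∀ R h, sideNormal n R h k = sideNormal n R h (j : ℕ) := by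
  have hpos : (0 : ℤ) < 2 * n := by omega
  have h0 := Int.emod_nonneg k hpos.ne'
  have h1 := Int.emod_lt_of_pos k hpos
  have h2 := Int.emod_add_mul_ediv k (2 * n)
  refine ⟨⟨(k % (2 * n)).toNat, by omega⟩, ?_, fun R h => ?_⟩
  · simp only [Int.toNat_of_nonneg h0]
    conv_lhs => rw [← h2, mul_assoc]
    refine ⟨fun h => ?_, fun h => h.add_even (even_two_mul _)⟩
    have h3 := h.sub_even (even_two_mul (n * (k / (2 * n)) : ℤ))
    rwa [add_sub_cancel_right] at h3
  · simp only [Int.toNat_of_nonneg h0]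
    rw [← sideNormal_add_period hn _ (k % (2 * n)) (k / (2 * n)), h2]

theorem cutPyramid_univ_eq (hn : 0 < n) :
    cutPyramid n R a b Set.univ = polyhedron (facetNormal n R a b) fun _ => 1 := by
  ext x
  rw [mem_cutPyramid]
  refine ⟨fun h => ?_, fun h => ⟨fun k _ => ?_, fun k => ?_⟩⟩
  · rintro (k | k)
    · exact h.1 _ (Set.mem_univ _)
    · exact h.2 _
  · obtain ⟨j, -, hj⟩ := exists_fin_sideNormal_eq hn k
    rw [hj]
    exact h (Sum.inl j)
  · obtain ⟨j, -, hj⟩ := exists_fin_sideNormal_eq hn k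
    rw [hj]
    exact h (Sum.inr j)

theorem facetNormal_dotProduct_zero (i : Fin (2 * n) ⊕ Fin (2 * n)) :
    facetNormal n R a b i ⬝ᵥ 0 < 1 := by simp

theorem sideNormal_dotProduct_inner (hn : 3 ≤ n) (hR : 0 < R) (h z : ℝ) (j k : ℤ) :
    sideNormal n R h j ⬝ᵥ cylPoint n (R * cosk n 1 / 2) z (2 * k + 1) =
      cosk n (2 * (j - k)) / 2 + h * z := by
  have h1 := cosk_one_pos hn
  rw [sideNormal_dotProduct_cylPoint, show 2 * j + 1 - (2 * k + 1) = 2 * (j - k) by ring]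
  field_simp

theorem irredundant_facetNormal (hn : 3 ≤ n) (hR : 0 < R) (ha : 0 < a) (hb : 0 < b) :
    Irredundant (facetNormal n R a b) fun _ => 1 := by
  have hlt : ∀ j k : Fin (2 * n), j ≠ k → cosk n (2 * (((j : ℕ) : ℤ) - (k : ℕ))) < 1 := by
    intro j k hjk
    have hjk' : (j : ℕ) ≠ k := fun h => hjk (Fin.ext h)
    refine cosk_lt_one (by omega) (by omega) ?_
    rw [abs_lt]
    constructor <;> omega
  have hab : 0 < a⁻¹ * b := by positivity
  have hba : 0 < b⁻¹ * a := by positivity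
  have haa : a⁻¹ * a = 1 := inv_mul_cancel₀ ha.ne'
  have hbb : b⁻¹ * b = 1 := inv_mul_cancel₀ hb.ne'
  refine ⟨⟨0, facetNormal_dotProduct_zero⟩, ?_⟩
  rintro (k | k)
  -- Halfway between the midpoint of the side and the top apex, in the relative interior of the
  -- facet.
  · refine ⟨cylPoint n (R * cosk n 1 / 2) (a / 2) (2 * (k : ℕ) + 1), ?_, ?_⟩
    · simp only [facetNormal, Sum.elim_inl, sideNormal_dotProduct_inner hn hR, sub_self, mul_zero,
        cosk_zero]
      linarith
    · rintro (j | j) hj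
      · simp only [facetNormal, Sum.elim_inl, sideNormal_dotProduct_inner hn hR]
        linarith [hlt j k fun h => hj (congrArg _ h)]
      · simp only [facetNormal, Sum.elim_inr, sideNormal_dotProduct_inner hn hR]
        linarith [cosk_le_one (n := n) (2 * (((j : ℕ) : ℤ) - (k : ℕ)))]
  · refine ⟨cylPoint n (R * cosk n 1 / 2) (-b / 2) (2 * (k : ℕ) + 1), ?_, ?_⟩
    · simp only [facetNormal, Sum.elim_inr, sideNormal_dotProduct_inner hn hR, sub_self, mul_zero,
        cosk_zero]
      linarith
    · rintro (j | j) hj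
      · simp only [facetNormal, Sum.elim_inl, sideNormal_dotProduct_inner hn hR]
        linarith [cosk_le_one (n := n) (2 * (((j : ℕ) : ℤ) - (k : ℕ)))]
      · simp only [facetNormal, Sum.elim_inr, sideNormal_dotProduct_inner hn hR]
        linarith [hlt j k fun h => hj (congrArg _ h)]

theorem isBounded_bipyramid (hn : 0 < n) : Bornology.IsBounded (bipyramid n R a b) := by
  rw [bipyramid, range_gonVertex hn, isBounded_convexHull]
  refine Bornology.IsBounded.union ?_ (Set.toFinite _).isBounded
  refine (Metric.isBounded_Icc (fun _ => -|R|) fun _ => |R|).subset ?_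
  rintro _ ⟨k, rfl⟩
  have h : ∀ c : ℝ, |c| ≤ 1 → -|R| ≤ R * c ∧ R * c ≤ |R| := fun c hc => abs_le.1 (by
    rw [abs_mul]; exact mul_le_of_le_one_right (abs_nonneg R) hc)
  have h0 := h _ (Real.abs_cos_le_one (((2 * k : ℤ) : ℝ) * (Real.pi / (2 * n))))
  have h1 := h _ (Real.abs_sin_le_one (((2 * k : ℤ) : ℝ) * (Real.pi / (2 * n))))
  constructor
  · intro i
    fin_cases i
    · exact h0.1
    · exact h1.1
    · exact neg_nonpos.2 (abs_nonneg R)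
  · intro i
    fin_cases i
    · exact h0.2
    · exact h1.2
    · exact abs_nonneg R

/-- A compact convex face is the closed convex hull of its extreme points. These are vertices of the
double pyramid at which the inequality is tight: the top apex and the two ends of the side. -/
theorem face_inl_eq_topFacet (hn : 3 ≤ n) (hR : 0 < R) (ha : 0 < a) (hb : 0 < b)
    (k : Fin (2 * n)) : face (facetNormal n R a b) (fun _ => 1) (Sum.inl k) = topFacet n R a k := by
  have hn0 : 0 < n := by omega
  have hP : polyhedron (facetNormal n R a b) (fun _ => 1) = bipyramid n R a b := by
    rw [bipyramid_eq_cutPyramid hn hR ha hb, cutPyramid_univ_eq hn0]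
  rw [topFacet, gonVertex_eq_rim hn0, gonVertex_eq_rim hn0]
  push_cast
  refine Set.Subset.antisymm ?_ (convexHull_min ?_ (convex_face _))
  · have hcomp : IsCompact (face (facetNormal n R a b) (fun _ => 1) (Sum.inl k)) :=
      Metric.isCompact_of_isClosed_isBounded (isClosed_face _)
        ((isBounded_bipyramid hn0).subset fun x hx => hP ▸ hx.1)
    rw [← closure_convexHull_extremePoints hcomp (convex_face _)]
    refine closure_minimal (convexHull_mono ?_) ((Set.toFinite _).isClosed_convexHull (𝕜 := ℝ))
    intro x hx
    have hxV : x ∈ (polyhedron (facetNormal n R a b) fun _ => 1).extremePoints ℝ :=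
      (isExtreme_face (Sum.inl k)).extremePoints_subset_extremePoints hx
    have hxk : sideNormal n R a⁻¹ (k : ℕ) ⬝ᵥ x = 1 := hx.1.2
    rw [hP, extremePoints_bipyramid hn hR ha hb] at hxV
    rcases hxV with ⟨j, rfl⟩ | rfl | rfl
    · exact Or.inr (rim_eq_of_sideNormal_eq hn hR _ hxk)
    · exact Or.inl rfl
    · rw [sideNormal_dotProduct_axis] at hxk
      have : 0 < a⁻¹ * b := by positivity
      linarith
  · have hmem : ∀ x ∈ (bipyramid n R a b), sideNormal n R a⁻¹ (k : ℕ) ⬝ᵥ x = 1 →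
        x ∈ face (facetNormal n R a b) (fun _ => 1) (Sum.inl k) := fun x hx h => ⟨hP ▸ hx, h⟩
    rw [bipyramid_eq_cutPyramid hn hR ha hb] at hmem
    rintro x (rfl | rfl | rfl)
    · exact hmem _ (top_mem_cutPyramid ha hb)
        ((sideNormal_dotProduct_axis _ _ _).trans (inv_mul_cancel₀ ha.ne'))
    · exact hmem _ (rim_mem_cutPyramid hn hR _) (sideNormal_dotProduct_rim_eq hn hR _ (Or.inl rfl))
    · exact hmem _ (rim_mem_cutPyramid hn hR _) (sideNormal_dotProduct_rim_eq hn hR _ (Or.inr rfl))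

/-! ### The double pyramid with every other top facet left out -/

theorem bipyramid_eq_polyhedron (hn : 3 ≤ n) (hR : 0 < R) (ha : 0 < a) (hb : 0 < b) :
    bipyramid n R a b = polyhedron (facetNormal n R a b) fun _ => 1 := by
  rw [bipyramid_eq_cutPyramid hn hR ha hb, cutPyramid_univ_eq (by omega)]

theorem exists_reducedBipyramid_eq (hn : 3 ≤ n) (hR : 0 < R) (ha : 0 < a) (hb : 0 < b) :
    ∃ J : Set (Fin (2 * n) ⊕ Fin (2 * n)),
      (∀ k : Fin (2 * n), Sum.inl k ∈ J ↔ Odd ((k : ℕ) : ℤ)) ∧ (∀ k, Sum.inr k ∈ J) ∧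
      reducedBipyramid n R a b = {x | ∀ i ∈ J, facetNormal n R a b i ⬝ᵥ x ≤ 1} := by
  have hirr := irredundant_facetNormal hn hR ha hb
  set F := face (facetNormal n R a b) (fun _ => 1) with hF
  set S : Set (Set (Fin 3 → ℝ)) := {G | ∃ j : ℕ, j < n ∧ G = topFacet n R a (2 * j)} with hS
  have htop : ∀ j : ℕ, ∀ hj : j < n, topFacet n R a (2 * j) = F (Sum.inl ⟨2 * j, by omega⟩) :=
    fun j hj => (face_inl_eq_topFacet hn hR ha hb ⟨2 * j, by omega⟩).symm
  -- The indices of the facets that are kept. Since distinct inequalities have distinct faces, the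
  -- omitted facets are exactly the top ones of even index.
  refine ⟨F ⁻¹' Sᶜ, fun k => ?_, fun k => ?_, ?_⟩
  · rw [Set.mem_preimage, Set.mem_compl_iff, ← Int.not_even_iff_odd, not_iff_not, Int.even_coe_nat]
    constructor
    · rintro ⟨j, hj, h⟩
      rw [htop j hj] at h
      have := Sum.inl_injective (hirr.face_injective h)
      rw [this]
      exact even_two_mul j
    · intro hk
      obtain ⟨j, hj⟩ := even_iff_two_dvd.1 hk
      have hjn : j < n := by omega
      refine ⟨j, hjn, ?_⟩
      rw [htop j hjn]
      exact congrArg (fun i => F (Sum.inl i)) (Fin.ext hj)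
  · rintro ⟨j, hj, h⟩
    rw [htop j hj] at h
    exact Sum.inr_ne_inl (hirr.face_injective h)
  · rw [reducedBipyramid, bipyramid_eq_polyhedron hn hR ha hb, hirr.facets_eq,
      ← hirr.boundedBy_image_face, Set.image_preimage_eq_range_inter]
    rfl

theorem reducedBipyramid_eq_cutPyramid (hn : 3 ≤ n) (hR : 0 < R) (ha : 0 < a) (hb : 0 < b) :
    reducedBipyramid n R a b = cutPyramid n R a b {k | Odd k} := by
  obtain ⟨J, hl, hr, hJ⟩ := exists_reducedBipyramid_eq hn hR ha hb
  rw [hJ]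
  ext x
  rw [mem_cutPyramid]
  refine ⟨fun h => ⟨fun k hk => ?_, fun k => ?_⟩, fun h => ?_⟩
  · obtain ⟨j, hodd, hj⟩ := exists_fin_sideNormal_eq (n := n) (by omega) k
    rw [hj]
    exact h (Sum.inl j) ((hl j).2 (hodd.1 hk))
  · obtain ⟨j, -, hj⟩ := exists_fin_sideNormal_eq (n := n) (by omega) k
    rw [hj]
    exact h (Sum.inr j) (hr j)
  · rintro (k | k) hk
    · exact h.1 _ ((hl k).1 hk)
    · exact h.2 _

theorem isFullPolytope_bipyramid (hn : 3 ≤ n) (hR : 0 < R) (ha : 0 < a) (hb : 0 < b) :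
    IsFullPolytope (bipyramid n R a b) := by
  have hbd := isBounded_bipyramid (n := n) (R := R) (a := a) (b := b) (by omega)
  rw [bipyramid_eq_polyhedron hn hR ha hb] at hbd ⊢
  exact isFullPolytope_polyhedron facetNormal_dotProduct_zero hbd

theorem isFullPolytope_reducedBipyramid (hn : 3 ≤ n) (hR : 0 < R) (ha : 0 < a) (hb : 0 < b) :
    IsFullPolytope (reducedBipyramid n R a b) := by
  have hbd : Bornology.IsBounded (reducedBipyramid n R a b) := by
    rw [reducedBipyramid_eq_cutPyramid hn hR ha hb, cutPyramid_odd_eq hn hR ha hb,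
      isBounded_convexHull]
    refine (Set.finite_of_encard_eq_coe (k := 3 * n + 2) ?_).isBounded
    rw [encard_reducedVertices hn hR ha hb]
    norm_cast
  obtain ⟨J, -, -, hJ⟩ := exists_reducedBipyramid_eq hn hR ha hb
  have hP : reducedBipyramid n R a b =
      polyhedron (fun i : J => facetNormal n R a b i) fun _ => 1 := by
    rw [hJ]
    ext x
    simp [polyhedron]
  rw [hP] at hbd ⊢
  exact isFullPolytope_polyhedron (fun i => facetNormal_dotProduct_zero i.1) hbd

end Halfspaces

theorem mainTheorem2 :
    -- intermediate polytopes of the algorithm, for a three-dimensional objective space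
    (∀ (m n : ℕ) (D : Benson.Problem 3 m n) (q : Fin 3 → ℝ),
      (∀ y ∈ D.Q, 0 ≤ y) → (0 : Fin 3 → ℝ) ∉ D.Q → q ∈ interior D.Qplus →
      ∀ (N M : ℕ) (σ : ℕ → Benson.State 3), Benson.IsRun D q N σ → N ≤ M →
        ∀ i ≤ N, (Benson.vertices (σ i).planes).encard ≤ 2 * M) ∧
    -- vertices and facets of a three-dimensional convex polytope
    (∀ X : Set (Fin 3 → ℝ), IsFullPolytope X →
      (facets X).Finite ∧ (Set.extremePoints ℝ X).encard + 4 ≤ 2 * (facets X).encard) ∧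
    -- the double pyramid
    (∀ (n : ℕ) (R a b : ℝ), 3 ≤ n → 0 < R → 0 < a → 0 < b →
      IsFullPolytope (bipyramid n R a b) ∧
      (Set.extremePoints ℝ (bipyramid n R a b)).encard = 2 * n + 2 ∧
      (facets (bipyramid n R a b)).encard = 4 * n ∧
      IsFullPolytope (reducedBipyramid n R a b) ∧
      (Set.extremePoints ℝ (reducedBipyramid n R a b)).encard = 3 * n + 2) := by
  refine ⟨fun m n D q hQ h0 hq N M σ hrun hNM i hi => ?_,
    fun X hX => Halfspaces.facets_finite_and_encard_le hX, fun n R a b hn hR ha hb =>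
      ⟨Halfspaces.isFullPolytope_bipyramid hn hR ha hb, ?_, ?_,
        Halfspaces.isFullPolytope_reducedBipyramid hn hR ha hb, ?_⟩⟩
  · refine (hrun.encard_vertices_le hQ h0 hq hi).trans ?_
    norm_cast
    omega
  · rw [Halfspaces.extremePoints_bipyramid hn hR ha hb,
      Halfspaces.encard_base (by omega) hR ha hb]
  · rw [Halfspaces.bipyramid_eq_polyhedron hn hR ha hb,
      (Halfspaces.irredundant_facetNormal hn hR ha hb).encard_facets]
    simp only [Fintype.card_sum, Fintype.card_fin]
    norm_cast
    ring
  · rw [Halfspaces.reducedBipyramid_eq_cutPyramid hn hR ha hb,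
      Halfspaces.extremePoints_cutPyramid_odd hn hR ha hb,
      Halfspaces.encard_reducedVertices hn hR ha hb]
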